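/- Let $n>1$ be an odd integer and let $G=H\times\langle a\rangle$, where $H\cong\mathbb{Z}_{2n}$ and $\langle a\rangle\cong\mathbb{Z}_2$. Let $b$ be the unique involution of $H$ and let $H_0$ be the subgroup of $H$ of order $n$. For $X\subseteq G$ write $\underline{X}=\sum_{x\in X}x\in\mathbb{Z}G$ and $\mathrm{rad}(X)=\{g\in G: Xg=X \text{ and } gX=X\}$. Recall that a Schur ring (S-ring) over $G$ is a subring $\mathcal{A}$ of $\mathbb{Z}G$ for which there is a partition $\mathcal{S}(\mathcal{A})$ of $G$, whose classes are called the basic sets of $\mathcal{A}$, such that $\{1_G\}\in\mathcal{S}(\mathcal{A})$, $X^{-1}\in\mathcal{S}(\mathcal{A})$ for every $X\in\mathcal{S}(\mathcal{A})$, and $\mathcal{A}=\mathrm{Span}_{\mathbb{Z}}\{\underline{X}: X\in\mathcal{S}(\mathcal{A})\}$. If $\mathcal{A}$ is an S-ring over $G$ with $\underline{H}\in\mathcal{A}$ and $\underline{\{a\}}\notin\mathcal{A}$, then $\{a,ab\}$ is a basic set of $\mathcal{A}$, or $$\bigcap_{\substack{X\in\mathcal{S}(\mathcal{A})\\ X\cap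 H_0a\neq\emptyset}}\mathrm{rad}(X\cap H_0a)\neq 1.$$ -/

import Mathlib

open scoped Pointwise

noncomputable section

namespace SchurRings

/-- The element `∑ x ∈ X, x` of the integral group ring `ℤ G`, for a subset `X` of a finite
group `G`. -/
def underline {G : Type*} [Group G] [Finite G] (X : Set G) : MonoidAlgebra ℤ G :=
  ∑ x ∈ X.toFinite.toFinset, MonoidAlgebra.of ℤ G x

/-- A Schur ring over a finite group `G`: a subring of `ℤ G` which is the `ℤ`-span of the elements
`underline X`, where `X` runs over the classes (the basic sets) of a partition of `G` that
contains `{1}` and is closed under inversion. The partition is determined by the subring. -/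
structure SchurRing (G : Type*) [Group G] [Finite G] extends Subring (MonoidAlgebra ℤ G) where
  basicSets : Set (Set G)
  isPartition : Setoid.IsPartition basicSets
  one_mem_basicSets : {1} ∈ basicSets
  inv_mem_basicSets : ∀ X ∈ basicSets, X⁻¹ ∈ basicSets
  toSubring_eq_span : (toSubring : Set (MonoidAlgebra ℤ G)) =
    Submodule.span ℤ (underline '' basicSets)

/-- The radical `{g : Xg = X and gX = X}` of a subset `X` of a group. -/
def rad {G : Type*} [Group G] (X : Set G) : Subgroup G where
  carrier := {g | MulOpposite.op g • X = X ∧ g • X = X}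
  one_mem' := by simp
  mul_mem' := by
    rintro g h ⟨hg, hg'⟩ ⟨hh, hh'⟩
    refine ⟨?_, ?_⟩
    · rw [MulOpposite.op_mul, mul_smul, hg, hh]
    · rw [mul_smul, hh', hg']
  inv_mem' := by
    rintro g ⟨hg, hg'⟩
    refine ⟨?_, ?_⟩
    · rw [MulOpposite.op_inv, inv_smul_eq_iff, hg]
    · rw [inv_smul_eq_iff, hg']

end SchurRings

end

open scoped Pointwise

namespace SchurRings

/-! Write x ~ y (`Rel`) when x and y lie in one basic set, T for the basic set of a, and Q for the
largest closed subgroup inside H₀ (`core`). It suffices to find r ≠ 1 in H₀ with ha ~ rha for all h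
in H₀; `KleinExt.exists_radical` does this when T is neither {a} nor {a, ab}.

The tools are structure constants (`ncard_eq_of_rel`) and power maps. Reducing V² modulo 2 shows
that the h in H₀ for which exactly one of ha, hab lies in a closed set V outside H form a closed
set, hence lie in Q (`closed_xor`). So V is b-invariant away from Q. If V is b-invariant everywhere,
reducing V² modulo 4 shows that Va is closed (`closed_translate`), so ta stabilizes V for every t in
T (`translate_mem`). Put U₀ = {u ∈ H₀ : ub ~ b}; it is a subgroup and U₀ × {1, b} is closed
(`exists_bSubgroup`).

If a and ab are not related, parity of inverse-closed subsets of H₀ keeps T away from Qab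
(`not_rel_core_mul_ab`). Then r comes from U₀ if T meets H₀ab, and otherwise from T = Ja with J
inside Q; the invariance spreads by `rel_of_invariant`.

If a ~ ab and U₀ = 1, then {b} is basic, T = K{a, ab} for a subgroup K of H₀, and any nontrivial
element of K works (`exists_radical_of_cls_b`).

If a ~ ab and U₀ ≠ 1, take P ≤ U₀ of prime order p. Multipliers congruent to 1 modulo suitable
2cp^k, p-th powers modulo p, and a rigidity statement on correlations (`notMem_of_correlation`) show
that ha ~ hal for all l in P (`rel_mul_of_prime`). -/

theorem sum_pow_prime {R ι : Type*} [CommRing R] {q : ℕ} (hq : q.Prime) (s : Finset ι)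
    (f : ι → R) : ∃ r, (∑ i ∈ s, f i) ^ q = ∑ i ∈ s, f i ^ q + (q : R) * r := by
  classical
  induction s using Finset.induction_on with
  | empty => exact ⟨0, by simp [hq.ne_zero]⟩
  | insert i s hi ih =>
    obtain ⟨r, hr⟩ := ih
    obtain ⟨t, ht⟩ := exists_add_pow_prime_eq hq (f i) (∑ i ∈ s, f i)
    rw [Finset.sum_insert hi, Finset.sum_insert hi, ht, hr]
    exact ⟨r + f i * (∑ i ∈ s, f i) * t, by ring⟩

theorem coeff_natCast_mul {G : Type*} [CommGroup G] (q : ℕ) (f : MonoidAlgebra ℤ G) (g : G) :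
    ((q : MonoidAlgebra ℤ G) * f).coeff g = q * f.coeff g := by
  rw [← nsmul_eq_mul, MonoidAlgebra.coeff_smul_apply]; simp

theorem pow_injective_of_coprime {G : Type*} [CommGroup G] {m : ℕ} (hm : m.Coprime (Nat.card G)) :
    Function.Injective (fun x : G => x ^ m) :=
  (powCoprime hm.symm).injective

/-! ### Schur rings: closed sets, structure constants, power maps -/

section Basics

variable {G : Type*} [CommGroup G] [Finite G]

open Classical in
theorem coeff_underline (X : Set G) (g : G) :
    (underline X).coeff g = if g ∈ X then 1 else 0 := by
  unfold underline
  simp [MonoidAlgebra.coeff_sum, Finsupp.finsetSum_apply, Finsupp.single_apply]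

namespace SchurRing

/-- Two elements are related when they lie in a common basic set. -/
def Rel (A : SchurRing G) (x y : G) : Prop := ∃ X ∈ A.basicSets, x ∈ X ∧ y ∈ X

/-- A set is closed when it is a union of basic sets. -/
def Closed (A : SchurRing G) (V : Set G) : Prop := ∀ ⦃x y⦄, A.Rel x y → x ∈ V → y ∈ V

/-- The basic set containing `x`. -/
def cls (A : SchurRing G) (x : G) : Set G := {y | A.Rel x y}

variable {A : SchurRing G}

theorem Rel.refl (x : G) : A.Rel x x := by
  obtain ⟨X, ⟨hX, hx⟩, -⟩ := A.isPartition.2 x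
  exact ⟨X, hX, hx, hx⟩

theorem Rel.symm {x y : G} (h : A.Rel x y) : A.Rel y x := by
  obtain ⟨X, hX, hx, hy⟩ := h
  exact ⟨X, hX, hy, hx⟩

theorem basic_eq {X Y : Set G} {x : G} (hX : X ∈ A.basicSets) (hY : Y ∈ A.basicSets)
    (hx : x ∈ X) (hy : x ∈ Y) : X = Y :=
  (A.isPartition.2 x).unique ⟨hX, hx⟩ ⟨hY, hy⟩

theorem Rel.trans {x y z : G} (h : A.Rel x y) (h' : A.Rel y z) : A.Rel x z := by
  obtain ⟨X, hX, hx, hy⟩ := h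
  obtain ⟨Y, hY, hy', hz⟩ := h'
  obtain rfl := basic_eq hX hY hy hy'
  exact ⟨X, hX, hx, hz⟩

theorem mem_cls_self (x : G) : x ∈ A.cls x := Rel.refl x

theorem closed_cls (x : G) : A.Closed (A.cls x) := fun _ _ h hx => Rel.trans hx h

theorem cls_mem (x : G) : A.cls x ∈ A.basicSets := by
  obtain ⟨X, ⟨hX, hx⟩, -⟩ := A.isPartition.2 x
  convert hX
  ext y
  constructor
  · rintro ⟨Y, hY, hxY, hyY⟩
    rwa [basic_eq hX hY hx hxY]
  · exact fun hy => ⟨X, hX, hx, hy⟩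

theorem Closed.cls_subset {V : Set G} (hV : A.Closed V) {x : G} (hx : x ∈ V) : A.cls x ⊆ V :=
  fun _ hy => hV hy hx

theorem Closed.inter {V W : Set G} (hV : A.Closed V) (hW : A.Closed W) : A.Closed (V ∩ W) :=
  fun _ _ h hx => ⟨hV h hx.1, hW h hx.2⟩

theorem Closed.union {V W : Set G} (hV : A.Closed V) (hW : A.Closed W) : A.Closed (V ∪ W) :=
  fun _ _ h hx => hx.imp (fun k => hV h k) (fun k => hW h k)

theorem Closed.diff {V W : Set G} (hV : A.Closed V) (hW : A.Closed W) : A.Closed (V \ W) :=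
  fun _ _ h hx => ⟨hV h hx.1, fun k => hx.2 (hW h.symm k)⟩

theorem Rel.inv {x y : G} (h : A.Rel x y) : A.Rel x⁻¹ y⁻¹ := by
  obtain ⟨X, hX, hx, hy⟩ := h
  exact ⟨X⁻¹, A.inv_mem_basicSets X hX, by simpa using hx, by simpa using hy⟩

theorem Closed.inv {V : Set G} (hV : A.Closed V) : A.Closed V⁻¹ :=
  fun _ _ h hx => hV h.inv hx

theorem Rel.eq_one {x : G} (h : A.Rel 1 x) : x = 1 := by
  obtain ⟨X, hX, hx, hy⟩ := h
  rw [basic_eq hX A.one_mem_basicSets hx rfl] at hy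
  exact hy

theorem coeff_eq_of_rel {f : MonoidAlgebra ℤ G} (hf : f ∈ A.toSubring) {x y : G}
    (h : A.Rel x y) : f.coeff x = f.coeff y := by
  have hf' : f ∈ Submodule.span ℤ (underline '' A.basicSets) := by
    rw [← SetLike.mem_coe, ← A.toSubring_eq_span]; exact hf
  clear hf
  induction hf' using Submodule.span_induction with
  | mem f hf =>
    obtain ⟨X, hX, rfl⟩ := hf
    obtain ⟨Y, hY, hx, hy⟩ := h
    classical
    have : x ∈ X ↔ y ∈ X := by
      constructor
      · intro k; rwa [basic_eq hX hY k hx]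
      · intro k; rwa [basic_eq hX hY k hy]
    simp [coeff_underline, this]
  | zero => simp
  | add f g hf hg ihf ihg => simp [ihf, ihg]
  | smul c f hf ihf => rw [MonoidAlgebra.coeff_smul_apply, MonoidAlgebra.coeff_smul_apply, ihf]

theorem closed_of_underline_mem {V : Set G} (hV : underline V ∈ A.toSubring) : A.Closed V := by
  classical
  intro x y h hx
  have := coeff_eq_of_rel hV h
  rw [coeff_underline, coeff_underline, if_pos hx] at this
  by_contra hy
  simp [hy] at this

theorem Closed.underline_mem {V : Set G} (hV : A.Closed V) : underline V ∈ A.toSubring := by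
  classical
  have hfin : {X | X ∈ A.basicSets ∧ X ⊆ V}.Finite := Set.toFinite _
  have key : underline V = ∑ X ∈ hfin.toFinset, underline X := by
    ext g
    rw [MonoidAlgebra.coeff_sum, Finsupp.finsetSum_apply]
    simp only [coeff_underline]
    by_cases hg : g ∈ V
    · rw [if_pos hg, Finset.sum_eq_single_of_mem (A.cls g)]
      · rw [if_pos (mem_cls_self g)]
      · simpa using ⟨cls_mem g, hV.cls_subset hg⟩
      · intro X hX hne
        rw [if_neg]
        intro hgX
        simp only [Set.Finite.mem_toFinset, Set.mem_ofPred_eq] at hX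
        exact hne (basic_eq hX.1 (cls_mem g) hgX (mem_cls_self g))
    · rw [if_neg hg, Finset.sum_eq_zero]
      intro X hX
      simp only [Set.Finite.mem_toFinset, Set.mem_ofPred_eq] at hX
      rw [if_neg (fun h => hg (hX.2 h))]
  rw [key]
  refine Subring.sum_mem _ fun X hX => ?_
  simp only [Set.Finite.mem_toFinset, Set.mem_ofPred_eq] at hX
  rw [← SetLike.mem_coe, A.toSubring_eq_span]
  exact Submodule.subset_span ⟨X, hX.1, rfl⟩

theorem coeff_underline_mul (X Y : Set G) (g : G) :
    (underline X * underline Y).coeff g = ({x | x ∈ X ∧ x⁻¹ * g ∈ Y}.ncard : ℤ) := by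
  classical
  have : underline X * underline Y =
      ∑ x ∈ X.toFinite.toFinset, MonoidAlgebra.single x (1 : ℤ) * underline Y := by
    conv_lhs => rw [underline]
    rw [Finset.sum_mul]; rfl
  rw [this, MonoidAlgebra.coeff_sum, Finsupp.finsetSum_apply]
  simp only [MonoidAlgebra.coeff_single_mul_apply, one_mul, coeff_underline]
  rw [Finset.sum_boole, Set.ncard_eq_toFinset_card _ (Set.toFinite _)]
  congr 2
  ext x
  simp

/-- The structure constants of a Schur ring: the number of `y ∈ Y` with `x * y ∈ Z` depends only
on the basic set of `x`. -/
theorem ncard_eq_of_rel {Z Y : Set G} (hZ : A.Closed Z) (hY : A.Closed Y) {x x' : G}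
    (h : A.Rel x x') :
    {y | y ∈ Y ∧ x * y ∈ Z}.ncard = {y | y ∈ Y ∧ x' * y ∈ Z}.ncard := by
  have key := coeff_eq_of_rel (A.toSubring.mul_mem hY.inv.underline_mem hZ.underline_mem) h
  rw [coeff_underline_mul, coeff_underline_mul] at key
  have e : ∀ z : G, {y | y ∈ Y⁻¹ ∧ y⁻¹ * z ∈ Z} = {y | y ∈ Y ∧ z * y ∈ Z}⁻¹ := by
    intro z; ext y; simp [mul_comm]
  rw [e, e, Set.ncard_inv, Set.ncard_inv] at key
  exact_mod_cast key

/-- The structure constant attains its maximum |Y| at x, hence at every related element. This is how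
inclusions propagate along a basic set. -/
theorem forall_mul_mem_of_rel {Z Y : Set G} (hZ : A.Closed Z) (hY : A.Closed Y) {x x' : G}
    (h : A.Rel x x') (hx : ∀ y ∈ Y, x * y ∈ Z) : ∀ y ∈ Y, x' * y ∈ Z := by
  have key := ncard_eq_of_rel hZ hY h
  have e : {y | y ∈ Y ∧ x * y ∈ Z} = Y := by
    ext y; exact ⟨fun k => k.1, fun k => ⟨k, hx y k⟩⟩
  rw [e] at key
  have := Set.eq_of_subset_of_ncard_le (s := {y | y ∈ Y ∧ x' * y ∈ Z}) (t := Y)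
    (fun y k => k.1) key.le
  intro y hy
  rw [← this] at hy
  exact hy.2

theorem Closed.mul {X Y : Set G} (hX : A.Closed X) (hY : A.Closed Y) : A.Closed (X * Y) := by
  intro x x' h hx
  have key := ncard_eq_of_rel hX hY.inv h
  obtain ⟨u, hu, v, hv, rfl⟩ := hx
  have hne : {y | y ∈ Y⁻¹ ∧ u * v * y ∈ X}.Nonempty := ⟨v⁻¹, by simpa using hv, by simpa using hu⟩
  have hpos := (Set.ncard_pos).2 hne
  rw [key] at hpos
  obtain ⟨y, hy, hy'⟩ := (Set.ncard_pos).1 hpos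
  exact ⟨x' * y, hy', y⁻¹, hy, by simp⟩

/-- Translation by an element related to an element stabilizing a closed set stabilizes it. -/
theorem Closed.stab {V : Set G} (hV : A.Closed V) {g g' : G} (h : A.Rel g g')
    (hg : ∀ v ∈ V, g * v ∈ V) : ∀ v ∈ V, g' * v ∈ V :=
  forall_mul_mem_of_rel hV hV h hg

/-- Cross terms in a q-th power are divisible by q, so modulo q a coefficient counts the q-th roots
of g in V. -/
theorem underline_pow_prime {q : ℕ} (hq : q.Prime) (V : Set G) :
    ∃ r : MonoidAlgebra ℤ G, ∀ g, (underline V ^ q).coeff g =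
      ({x | x ∈ V ∧ x ^ q = g}.ncard : ℤ) + q * r.coeff g := by
  classical
  obtain ⟨r, hr⟩ := sum_pow_prime hq V.toFinite.toFinset (fun x => MonoidAlgebra.of ℤ G x)
  refine ⟨r, fun g => ?_⟩
  have : underline V ^ q = _ := hr
  rw [this, MonoidAlgebra.coeff_add, Finsupp.add_apply, coeff_natCast_mul,
    MonoidAlgebra.coeff_sum, Finsupp.finsetSum_apply]
  congr 1
  simp only [MonoidAlgebra.of_apply, MonoidAlgebra.single_pow, one_pow, MonoidAlgebra.coeff_single,
    Finsupp.single_apply]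
  rw [Finset.sum_boole, Set.ncard_eq_toFinset_card _ (Set.toFinite _)]
  congr 2
  ext x
  simp

/-- Schur–Wielandt: the `q`-th powers hit a number of times prime to `q` form a closed set. -/
theorem Closed.frobenius {V : Set G} (hV : A.Closed V) {q : ℕ} (hq : q.Prime) :
    A.Closed {g | ¬ q ∣ {x | x ∈ V ∧ x ^ q = g}.ncard} := by
  obtain ⟨r, hr⟩ := underline_pow_prime hq V
  intro g g' h hg hg'
  apply hg
  have key := coeff_eq_of_rel (A.toSubring.pow_mem hV.underline_mem q) h
  rw [hr, hr] at key
  have : (q : ℤ) ∣ ({x | x ∈ V ∧ x ^ q = g'}.ncard : ℤ) := by exact_mod_cast hg'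
  have h2 : (q : ℤ) ∣ ({x | x ∈ V ∧ x ^ q = g}.ncard : ℤ) := by
    have e : ({x | x ∈ V ∧ x ^ q = g}.ncard : ℤ) =
      ({x | x ∈ V ∧ x ^ q = g'}.ncard : ℤ) + q * (r.coeff g' - r.coeff g) := by linarith
    rw [e]
    exact dvd_add this (dvd_mul_right _ _)
  exact_mod_cast h2

/-- For a prime not dividing |G| the power map is injective, so its fibres have size 0 or 1 and
`Closed.frobenius` returns exactly the image. Prime factors of m are then treated one at a time. -/
theorem Closed.image_pow {m : ℕ} (hm : m.Coprime (Nat.card G)) {V : Set G} (hV : A.Closed V) :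
    A.Closed ((fun x => x ^ m) '' V) := by
  induction m using induction_on_primes generalizing V with
  | zero =>
    have h1 : Nat.card G = 1 := by simpa using hm
    have := (Nat.card_eq_one_iff_unique.1 h1).1
    intro x y h hx
    rwa [Subsingleton.elim y x]
  | one => simpa using hV
  | prime_mul p m hp ih =>
    have hpc : p.Coprime (Nat.card G) := Nat.Coprime.coprime_mul_right hm
    have hmc : m.Coprime (Nat.card G) := Nat.Coprime.coprime_mul_left hm
    have h1 : A.Closed ((fun x => x ^ p) '' V) := by
      convert hV.frobenius hp using 1
      ext g
      constructor
      · rintro ⟨x, hx, rfl⟩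
        have : {y | y ∈ V ∧ y ^ p = x ^ p} = {x} := by
          ext y
          constructor
          · rintro ⟨-, h⟩
            exact pow_injective_of_coprime hpc h
          · rintro rfl
            exact ⟨hx, rfl⟩
        simp only [Set.mem_ofPred_eq, this, Set.ncard_singleton, Nat.dvd_one]
        exact hp.ne_one
      · intro hg
        have hne : {x | x ∈ V ∧ x ^ p = g}.Nonempty := by
          rw [Set.nonempty_iff_ne_empty]
          intro he
          simp [he] at hg
        obtain ⟨x, hx, rfl⟩ := hne
        exact ⟨x, hx, rfl⟩
    have h2 := ih hmc h1
    rw [Set.image_image] at h2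
    simpa [pow_mul] using h2

/-- Schur's theorem on multipliers. -/
theorem Rel.pow {m : ℕ} (hm : m.Coprime (Nat.card G)) {x y : G} (h : A.Rel x y) :
    A.Rel (x ^ m) (y ^ m) := by
  -- k inverts m modulo |G|, by Bézout.
  obtain ⟨k, hk⟩ : ∃ k : ℕ, ∀ z : G, (z ^ m) ^ k = z := by
    refine ⟨(Nat.gcdA m (Nat.card G) % Nat.card G).toNat, fun z => ?_⟩
    have hpos : (0 : ℤ) < Nat.card G := by exact_mod_cast Nat.card_pos
    have hb := Nat.gcd_eq_gcd_ab m (Nat.card G)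
    rw [hm.gcd_eq_one] at hb
    rw [← zpow_natCast, Int.toNat_of_nonneg (Int.emod_nonneg _ hpos.ne'), ← zpow_natCast z m,
      ← zpow_mul]
    have hz : z ^ (Nat.card G : ℤ) = 1 := by rw [zpow_natCast]; exact pow_card_eq_one'
    rw [Int.emod_def, mul_sub, zpow_sub, mul_left_comm, zpow_mul z (Nat.card G : ℤ), hz, one_zpow,
      inv_one, mul_one]
    have : (m : ℤ) * m.gcdA (Nat.card G) = 1 - Nat.card G * m.gcdB (Nat.card G) := by
      push_cast at hb; linarith
    rw [this, zpow_sub, zpow_mul, hz, one_zpow, inv_one, mul_one, zpow_one]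
  have hkc : k.Coprime (Nat.card G) := by
    by_contra hcon
    obtain ⟨q, hq, hqk, hqG⟩ := Nat.Prime.not_coprime_iff_dvd.1 hcon
    have := Fact.mk hq
    obtain ⟨z, hz⟩ := exists_prime_orderOf_dvd_card' q hqG
    have h1 := hk z
    rw [← pow_mul, orderOf_dvd_iff_pow_eq_one.1 (hz ▸ Dvd.dvd.mul_left hqk m)] at h1
    rw [← h1, orderOf_one] at hz
    exact hq.one_lt.ne hz
  -- The k-th powers of the basic set of x^m form a closed set containing x, hence y.
  have hW := (closed_cls (A := A) (x ^ m)).image_pow hkc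
  have hxW : x ∈ (fun z => z ^ k) '' A.cls (x ^ m) := ⟨x ^ m, mem_cls_self _, hk x⟩
  obtain ⟨w, hw, hwy⟩ := hW h hxW
  have : w = y ^ m := by
    apply pow_injective_of_coprime hkc
    simp only [hk]
    exact hwy
  rwa [this] at hw

end SchurRing

end Basics

/-- The largest closed subgroup contained in `K`. -/
def SchurRing.core {G : Type*} [CommGroup G] [Finite G] (A : SchurRing G) (K : Subgroup G) :
    Subgroup G where
  carrier := {x | A.cls x ⊆ K}
  one_mem' := by
    intro y hy
    rw [SchurRing.Rel.eq_one hy]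
    exact K.one_mem
  mul_mem' := by
    intro x y hx hy z hz
    have h := (SchurRing.closed_cls (A := A) x).mul (SchurRing.closed_cls (A := A) y)
    obtain ⟨u, hu, v, hv, rfl⟩ := h hz ⟨x, SchurRing.mem_cls_self x, y, SchurRing.mem_cls_self y, rfl⟩
    exact K.mul_mem (hx hu) (hy hv)
  inv_mem' := by
    intro x hx y hy
    have h : A.Rel x y⁻¹ := by simpa using SchurRing.Rel.inv hy
    simpa using hx h

/-! ### The configuration H₀ × {1, a, b, ab} and its elementary properties -/

/-- The ambient configuration: `G` is the internal direct product of a subgroup `H₀` of odd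
exponent `n` and the Klein four-group `{1, a, b, a * b}`, and `H` is `H₀ × {1, b}`. -/
structure KleinExt {G : Type*} [CommGroup G] (H H₀ : Subgroup G) (n : ℕ) (a b : G) : Prop where
  odd : Odd n
  card : Nat.card G = 4 * n
  pow_eq_one : ∀ h ∈ H₀, h ^ n = 1
  le : H₀ ≤ H
  b_mem : b ∈ H
  b_notMem : b ∉ H₀
  a_notMem : a ∉ H
  aa : a * a = 1
  bb : b * b = 1
  inside : ∀ g ∈ H, ∃ h ∈ H₀, g = h ∨ g = h * b
  outside : ∀ g ∉ H, ∃ h ∈ H₀, g = h * a ∨ g = h * (a * b)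

namespace KleinExt

variable {G : Type*} [CommGroup G] {H H₀ : Subgroup G} {n : ℕ} {a b : G}

theorem abab (S : KleinExt H H₀ n a b) : a * b * (a * b) = 1 := by
  rw [mul_mul_mul_comm, S.aa, S.bb, mul_one]

theorem inv_a (S : KleinExt H H₀ n a b) : a⁻¹ = a := inv_eq_of_mul_eq_one_left S.aa

theorem swap (S : KleinExt H H₀ n a b) : KleinExt H H₀ n (a * b) b where
  odd := S.odd
  card := S.card
  pow_eq_one := S.pow_eq_one
  le := S.le
  b_mem := S.b_mem
  b_notMem := S.b_notMem
  a_notMem := fun h => S.a_notMem (by simpa using H.mul_mem h (H.inv_mem S.b_mem))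
  aa := S.abab
  bb := S.bb
  inside := S.inside
  outside := by
    intro g hg
    obtain ⟨h, hh, k⟩ := S.outside g hg
    refine ⟨h, hh, ?_⟩
    rw [mul_assoc a, S.bb, mul_one]
    exact k.symm

theorem ab_b (S : KleinExt H H₀ n a b) : a * b * b = a := by rw [mul_assoc, S.bb, mul_one]

theorem mul_a_notMem (S : KleinExt H H₀ n a b) {h : G} (hh : h ∈ H₀) : h * a ∉ H :=
  fun k => S.a_notMem ((H.mul_mem_cancel_left (S.le hh)).1 k)

theorem mul_b_notMem (S : KleinExt H H₀ n a b) {h : G} (hh : h ∈ H₀) : h * b ∉ H₀ :=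
  fun k => S.b_notMem ((H₀.mul_mem_cancel_left hh).1 k)

theorem ne_ab (S : KleinExt H H₀ n a b) {h h' : G} (hh : h ∈ H₀) (hh' : h' ∈ H₀) :
    h * a ≠ h' * (a * b) := by
  intro k
  apply S.b_notMem
  have : b = h'⁻¹ * h := by
    have : h * a = h' * b * a := by rw [k]; simp [mul_comm, mul_left_comm]
    rw [mul_right_cancel this]; simp
  rw [this]
  exact H₀.mul_mem (H₀.inv_mem hh') hh

theorem eq_one_of_sq (S : KleinExt H H₀ n a b) {h : G} (hh : h ∈ H₀) (h2 : h * h = 1) :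
    h = 1 := by
  obtain ⟨k, hk⟩ := S.odd
  have := S.pow_eq_one h hh
  rwa [hk, pow_succ, pow_mul, pow_two, h2, one_pow, one_mul] at this

theorem sq_inj (S : KleinExt H H₀ n a b) {h h' : G} (hh : h ∈ H₀) (hh' : h' ∈ H₀)
    (h2 : h * h = h' * h') : h = h' := by
  have := S.eq_one_of_sq (H₀.mul_mem hh (H₀.inv_mem hh')) (by
    rw [mul_mul_mul_comm, h2, ← mul_inv, mul_inv_cancel])
  exact mul_inv_eq_one.1 this

/-- A multiplier that inverts squaring on `H₀`. -/
theorem exists_half (S : KleinExt H H₀ n a b) :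
    ∃ m : ℕ, m.Coprime (Nat.card G) ∧ Odd m ∧ ∀ h ∈ H₀, (h * h) ^ m = h := by
  -- m represents 1/2 modulo n. It is (1 + n)/2 or (1 + 3n)/2 according to n modulo 4, so that it is
  -- odd: this makes it prime to 4n and lets it fix b.
  have key : ∃ m r : ℕ, Odd m ∧ 2 * m = 1 + n * r := by
    obtain ⟨k, hk⟩ := S.odd
    rcases Nat.even_or_odd k with ⟨j, hj⟩ | ⟨j, hj⟩
    · exact ⟨2 * j + 1, 1, ⟨j, rfl⟩, by omega⟩
    · exact ⟨6 * j + 5, 3, ⟨3 * j + 2, by omega⟩, by omega⟩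
  obtain ⟨m, r, hm, hr⟩ := key
  refine ⟨m, ?_, hm, fun h hh => ?_⟩
  · rw [S.card]
    refine Nat.Coprime.mul_right ?_ ?_
    · exact (Nat.coprime_two_right.2 hm).pow_right 2
    · by_contra hcon
      obtain ⟨q, hq, hqm, hqn⟩ := Nat.Prime.not_coprime_iff_dvd.1 hcon
      have h1 : q ∣ 1 + n * r := hr ▸ Dvd.dvd.mul_left hqm 2
      exact hq.one_lt.ne' (Nat.dvd_one.1 ((Nat.dvd_add_left (Dvd.dvd.mul_right hqn r)).1 h1))
  · rw [← pow_two, ← pow_mul, hr, pow_add, pow_mul, S.pow_eq_one h hh, one_pow, pow_one, mul_one]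

end KleinExt

/-! ### Squares modulo 2 and modulo 4 -/

section Setting

variable {G : Type*} [CommGroup G] [Finite G] {A : SchurRing G}

open SchurRing

theorem SchurRing.closed_core (K : Subgroup G) : A.Closed (A.core K : Set G) :=
  fun _ _ h hx _ hz => hx (h.trans hz)

theorem SchurRing.core_le (K : Subgroup G) : A.core K ≤ K := fun x hx => hx (mem_cls_self x)

theorem SchurRing.Closed.subset_core {K : Subgroup G} {V : Set G} (hV : A.Closed V)
    (hVK : V ⊆ K) : V ⊆ A.core K := fun _ hx _ hy => hVK (hV hy hx)

namespace KleinExt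

variable {H H₀ : Subgroup G} {n : ℕ} {a b : G}

theorem closed_of_squares (S : KleinExt H H₀ n a b) {D W : Set G} (hW : A.Closed W)
    (hDW : W = (fun h => h * h) '' D) (hD : D ⊆ H₀) : A.Closed D := by
  obtain ⟨m, hm, -, hmh⟩ := S.exists_half
  convert hW.image_pow hm using 1
  rw [hDW, Set.image_image]
  ext x
  constructor
  · exact fun hx => ⟨x, hx, hmh x (hD hx)⟩
  · rintro ⟨y, hy, rfl⟩
    simpa [hmh y (hD hy)] using hy

/-- Both he and he' square to h², and squaring is injective on H₀. Hence h² has an odd number of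
square roots in V exactly when one of the two lies in V; the half multiplier then turns the closed
set of such h² into the set of such h. -/
theorem closed_xor (S : KleinExt H H₀ n a b) {V : Set G} (hV : A.Closed V) {e e' : G}
    (he : e * e = 1) (he' : e' * e' = 1) (hne : ∀ h ∈ H₀, ∀ h' ∈ H₀, h * e ≠ h' * e')
    (hcov : ∀ v ∈ V, ∃ h ∈ H₀, v = h * e ∨ v = h * e') :
    A.Closed {h | h ∈ H₀ ∧ ¬ (h * e ∈ V ↔ h * e' ∈ V)} := by
  refine S.closed_of_squares (hV.frobenius Nat.prime_two) ?_ (fun h hh => hh.1)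
  have sqe : ∀ h : G, (h * e) ^ 2 = h * h := fun h => by
    rw [pow_two, mul_mul_mul_comm, he, mul_one]
  have sqe' : ∀ h : G, (h * e') ^ 2 = h * h := fun h => by
    rw [pow_two, mul_mul_mul_comm, he', mul_one]
  have key : ∀ h ∈ H₀, {x | x ∈ V ∧ x ^ 2 = h * h} = {x | x ∈ V ∧ (x = h * e ∨ x = h * e')} := by
    intro h hh
    ext x
    constructor
    · rintro ⟨hx, hx2⟩
      obtain ⟨k, hk, rfl | rfl⟩ := hcov x hx
      · rw [sqe] at hx2
        rw [S.sq_inj hk hh hx2] at hx ⊢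
        exact ⟨hx, Or.inl rfl⟩
      · rw [sqe'] at hx2
        rw [S.sq_inj hk hh hx2] at hx ⊢
        exact ⟨hx, Or.inr rfl⟩
    · rintro ⟨hx, rfl | rfl⟩
      · exact ⟨hx, sqe h⟩
      · exact ⟨hx, sqe' h⟩
  have par : ∀ h ∈ H₀, (¬ 2 ∣ {x | x ∈ V ∧ x ^ 2 = h * h}.ncard) ↔
      ¬ (h * e ∈ V ↔ h * e' ∈ V) := by
    intro h hh
    rw [key h hh]
    by_cases h1 : h * e ∈ V <;> by_cases h2 : h * e' ∈ V
    · have : {x | x ∈ V ∧ (x = h * e ∨ x = h * e')} = {h * e, h * e'} := by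
        ext x; constructor
        · exact fun k => k.2
        · rintro (rfl | rfl)
          · exact ⟨h1, Or.inl rfl⟩
          · exact ⟨h2, Or.inr rfl⟩
      rw [this, Set.ncard_pair (hne h hh h hh)]
      simp [h1, h2]
    · have : {x | x ∈ V ∧ (x = h * e ∨ x = h * e')} = {h * e} := by
        ext x; constructor
        · rintro ⟨hx, rfl | rfl⟩
          · rfl
          · exact absurd hx h2
        · rintro rfl
          exact ⟨h1, Or.inl rfl⟩
      rw [this, Set.ncard_singleton]
      simp [h1, h2]
    · have : {x | x ∈ V ∧ (x = h * e ∨ x = h * e')} = {h * e'} := by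
        ext x; constructor
        · rintro ⟨hx, rfl | rfl⟩
          · exact absurd hx h1
          · rfl
        · rintro rfl
          exact ⟨h2, Or.inr rfl⟩
      rw [this, Set.ncard_singleton]
      simp [h1, h2]
    · have : {x | x ∈ V ∧ (x = h * e ∨ x = h * e')} = ∅ := by
        ext x; constructor
        · rintro ⟨hx, rfl | rfl⟩
          · exact absurd hx h1
          · exact absurd hx h2
        · exact fun k => k.elim
      rw [this, Set.ncard_empty]
      simp [h1, h2]
  ext g
  constructor
  · intro hg
    have hne : {x | x ∈ V ∧ x ^ 2 = g}.Nonempty := by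
      rw [Set.nonempty_iff_ne_empty]
      intro h0
      simp [h0] at hg
    obtain ⟨x, hx, hxg⟩ := hne
    obtain ⟨h, hh, hxh⟩ := hcov x hx
    have hgh : h * h = g := by
      rcases hxh with rfl | rfl
      · rw [← hxg, sqe]
      · rw [← hxg, sqe']
    refine ⟨h, ⟨hh, (par h hh).1 ?_⟩, hgh⟩
    rw [hgh]
    exact hg
  · rintro ⟨h, ⟨hh, hx⟩, rfl⟩
    exact (par h hh).2 hx

/-- For a closed set outside `H`, the elements of `H₀` seen exactly once form a closed set. -/
theorem closed_xor_outside (S : KleinExt H H₀ n a b) {V : Set G} (hV : A.Closed V)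
    (hVH : ∀ v ∈ V, v ∉ H) : A.Closed {h | h ∈ H₀ ∧ ¬ (h * a ∈ V ↔ h * (a * b) ∈ V)} :=
  S.closed_xor hV S.aa S.abab (fun _ hh _ hh' => S.ne_ab hh hh') (fun v hv => S.outside v (hVH v hv))

/-- For a closed set inside `H`, the elements of `H₀` seen exactly once form a closed set. -/
theorem closed_xor_inside (S : KleinExt H H₀ n a b) {V : Set G} (hV : A.Closed V)
    (hVH : ∀ v ∈ V, v ∈ H) : A.Closed {h | h ∈ H₀ ∧ ¬ (h ∈ V ↔ h * b ∈ V)} := by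
  have := S.closed_xor (e := 1) (e' := b) hV (mul_one 1) S.bb ?_ ?_
  · simpa using this
  · intro h hh h' hh' k
    rw [mul_one] at k
    exact S.mul_b_notMem hh' (k ▸ hh)
  · simpa using fun v hv => S.inside v (hVH v hv)

/-- Mostly used in contrapositive form: over an h outside the core, V contains both of ha, hab or
neither. -/
theorem mem_core_of_xor_outside (S : KleinExt H H₀ n a b) {V : Set G} (hV : A.Closed V)
    (hVH : ∀ v ∈ V, v ∉ H) {h : G} (hh : h ∈ H₀) (hx : ¬ (h * a ∈ V ↔ h * (a * b) ∈ V)) :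
    h ∈ A.core H₀ :=
  (S.closed_xor_outside hV hVH).subset_core (fun _ k => k.1) ⟨hh, hx⟩

theorem mem_core_of_xor_inside (S : KleinExt H H₀ n a b) {V : Set G} (hV : A.Closed V)
    (hVH : ∀ v ∈ V, v ∈ H) {h : G} (hh : h ∈ H₀) (hx : ¬ (h ∈ V ↔ h * b ∈ V)) :
    h ∈ A.core H₀ :=
  (S.closed_xor_inside hV hVH).subset_core (fun _ k => k.1) ⟨hh, hx⟩

/-- The translate by `a` of a `b`-invariant closed set outside `H` is closed. -/
theorem closed_translate (S : KleinExt H H₀ n a b) {V : Set G} (hV : A.Closed V)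
    (hVH : ∀ v ∈ V, v ∉ H) (hb : ∀ v ∈ V, v * b ∈ V) : A.Closed {g | g * a ∈ V} := by
  classical
  set V₀ : Set G := {h | h ∈ H₀ ∧ h * a ∈ V} with hV₀
  set K : Set G := {g | ∃ h ∈ V₀, g = h * h ∨ g = h * h * b} with hK
  have hab : ∀ h ∈ H₀, (h * (a * b) ∈ V ↔ h * a ∈ V) := by
    intro h hh
    constructor
    · intro k
      have := hb _ k
      rwa [mul_assoc, S.ab_b] at this
    · intro k
      have := hb _ k
      rwa [mul_assoc] at this
  have hVu : underline V = underline V₀ * (MonoidAlgebra.single a 1 +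
      MonoidAlgebra.single (a * b) 1) := by
    ext g
    rw [mul_add, MonoidAlgebra.coeff_add, Finsupp.add_apply,
      MonoidAlgebra.coeff_mul_single_apply, MonoidAlgebra.coeff_mul_single_apply,
      coeff_underline, coeff_underline, coeff_underline, mul_one, mul_one]
    have ia : a⁻¹ = a := inv_eq_of_mul_eq_one_left S.aa
    have iab : (a * b)⁻¹ = a * b := inv_eq_of_mul_eq_one_left S.abab
    rw [ia, iab]
    have e1 : ∀ g : G, g * a * a = g := fun g => by rw [mul_assoc, S.aa, mul_one]
    have e2 : ∀ g : G, g * (a * b) * (a * b) = g := fun g => by rw [mul_assoc, S.abab, mul_one]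
    by_cases hg : g ∈ V
    · obtain ⟨h, hh, rfl | rfl⟩ := S.outside g (hVH g hg)
      · have h1 : h * a * a ∈ V₀ := by rw [e1]; exact ⟨hh, hg⟩
        have h2 : h * a * (a * b) ∉ V₀ := by
          rw [← mul_assoc, e1]
          exact fun k => S.mul_b_notMem hh k.1
        rw [if_pos hg, if_pos h1, if_neg h2, add_zero]
      · have h1 : h * (a * b) * (a * b) ∈ V₀ := by rw [e2]; exact ⟨hh, (hab h hh).1 hg⟩
        have h2 : h * (a * b) * a ∉ V₀ := by
          rw [mul_comm a b, ← mul_assoc, e1]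
          exact fun k => S.mul_b_notMem hh k.1
        rw [if_pos hg, if_pos h1, if_neg h2, zero_add]
    · have h1 : g * a ∉ V₀ := fun k => hg (by have := k.2; rwa [e1] at this)
      have h2 : g * (a * b) ∉ V₀ := fun k => hg (by
        have := (hab _ k.1).2 k.2
        rwa [e2] at this)
      rw [if_neg hg, if_neg h1, if_neg h2, add_zero]
  obtain ⟨r, hr⟩ := sum_pow_prime Nat.prime_two V₀.toFinite.toFinset
    (fun x => MonoidAlgebra.of ℤ G x)
  -- Here V = V₀(a + ab) and (a + ab)² = 2(1 + b), while V₀² agrees modulo 2 with the sum of the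
  -- squares of its elements. So V² is 2K modulo 4, and K can be read off from the coefficients.
  have hsq : underline V ^ 2 = ((2 : ℕ) : MonoidAlgebra ℤ G) * underline K +
      ((4 : ℕ) : MonoidAlgebra ℤ G) * (r * (1 + MonoidAlgebra.single b 1)) := by
    have hKu : (∑ i ∈ V₀.toFinite.toFinset, MonoidAlgebra.of ℤ G i ^ 2) *
        (1 + MonoidAlgebra.single b 1) = underline K := by
      have hV2 : ∑ i ∈ V₀.toFinite.toFinset, MonoidAlgebra.of ℤ G i ^ 2 =
          underline ((fun h => h * h) '' V₀) := by
        have : ((fun h => h * h) '' V₀).toFinite.toFinset =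
            V₀.toFinite.toFinset.image (fun h => h * h) := by ext; simp
        rw [underline, this, Finset.sum_image]
        · simp [pow_two]
        · intro x hx y hy k
          simp only [Set.Finite.coe_toFinset] at hx hy
          exact S.sq_inj hx.1 hy.1 k
      rw [hV2]
      ext g
      rw [mul_add, mul_one, MonoidAlgebra.coeff_add, Finsupp.add_apply,
        MonoidAlgebra.coeff_mul_single_apply, coeff_underline, coeff_underline, coeff_underline,
        mul_one, inv_eq_of_mul_eq_one_left S.bb]
      have hKiff : g ∈ K ↔ (g ∈ (fun h => h * h) '' V₀ ∨ g * b ∈ (fun h => h * h) '' V₀) := by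
        constructor
        · rintro ⟨h, hh, rfl | rfl⟩
          · exact Or.inl ⟨h, hh, rfl⟩
          · exact Or.inr ⟨h, hh, by simp [mul_assoc, S.bb]⟩
        · rintro (⟨h, hh, rfl⟩ | ⟨h, hh, k⟩)
          · exact ⟨h, hh, Or.inl rfl⟩
          · exact ⟨h, hh, Or.inr (by simp only at k; rw [k, mul_assoc, S.bb, mul_one])⟩
      have hex : ¬ (g ∈ (fun h => h * h) '' V₀ ∧ g * b ∈ (fun h => h * h) '' V₀) := by
        rintro ⟨⟨h, hh, rfl⟩, ⟨k, hk, hkk⟩⟩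
        simp only at hkk
        exact S.mul_b_notMem (H₀.mul_mem hh.1 hh.1) (hkk ▸ H₀.mul_mem hk.1 hk.1)
      by_cases h1 : g ∈ (fun h => h * h) '' V₀ <;> by_cases h2 : g * b ∈ (fun h => h * h) '' V₀
      · exact absurd ⟨h1, h2⟩ hex
      · rw [if_pos h1, if_neg h2, if_pos (hKiff.2 (Or.inl h1)), add_zero]
      · rw [if_neg h1, if_pos h2, if_pos (hKiff.2 (Or.inr h2)), zero_add]
      · rw [if_neg h1, if_neg h2, if_neg (fun k => (hKiff.1 k).elim h1 h2), add_zero]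
    have hab2 : (MonoidAlgebra.single a (1 : ℤ) + MonoidAlgebra.single (a * b) 1) ^ 2 =
        2 * (1 + MonoidAlgebra.single b 1) := by
      rw [add_sq, MonoidAlgebra.single_pow, MonoidAlgebra.single_pow, pow_two a, pow_two (a * b), S.aa,
        S.abab, mul_assoc 2, MonoidAlgebra.single_mul_single, ← mul_assoc a, S.aa]
      simp only [one_mul, mul_one, one_pow, ← MonoidAlgebra.one_def]
      ring
    have hV0 : underline V₀ ^ 2 = _ := hr
    rw [hVu, mul_pow, hab2, hV0, ← hKu]
    push_cast
    ring
  have hclosed : A.Closed K := by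
    intro x y h hx
    have key := coeff_eq_of_rel (A.toSubring.pow_mem hV.underline_mem 2) h
    rw [hsq, MonoidAlgebra.coeff_add, Finsupp.add_apply, Finsupp.add_apply, coeff_natCast_mul,
      coeff_natCast_mul, coeff_natCast_mul, coeff_natCast_mul, coeff_underline, coeff_underline,
      if_pos hx] at key
    by_contra hy
    rw [if_neg hy] at key
    push_cast at key
    omega
  obtain ⟨m, hm, hmo, hmh⟩ := S.exists_half
  have hbm : b ^ m = b := by
    obtain ⟨k, rfl⟩ := hmo
    rw [pow_succ, pow_mul, pow_two, S.bb, one_pow, one_mul]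
  -- The odd half multiplier fixes b and undoes squaring on H₀, so it carries K to V₀{1, b} = Va.
  convert hclosed.image_pow hm using 1
  ext g
  constructor
  · intro hg
    obtain ⟨h, hh, k | k⟩ := S.outside _ (hVH _ hg)
    · have := mul_right_cancel k
      subst this
      exact ⟨g * g, ⟨g, ⟨hh, hg⟩, Or.inl rfl⟩, hmh g hh⟩
    · have : g = h * b := by
        rw [mul_comm a b, ← mul_assoc] at k
        exact mul_right_cancel k
      subst this
      refine ⟨h * h * b, ⟨h, ⟨hh, (hab h hh).1 (k ▸ hg)⟩, Or.inr rfl⟩, ?_⟩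
      simp only [mul_pow _ b, hmh h hh, hbm]
  · rintro ⟨x, ⟨h, hh, rfl | rfl⟩, rfl⟩
    · simpa [hmh h hh.1] using hh.2
    · simp only [mul_pow _ b, hmh h hh.1, hbm]
      have := hb _ hh.2
      rwa [mul_right_comm] at this

/-- A `b`-invariant closed set outside `H` is stable under translation by `t * a` for every `t`
related to `a`. -/
theorem translate_mem (S : KleinExt H H₀ n a b) {V : Set G} (hV : A.Closed V)
    (hVH : ∀ v ∈ V, v ∉ H) (hb : ∀ v ∈ V, v * b ∈ V) {t : G} (ht : A.Rel a t) :
    ∀ v ∈ V, t * a * v ∈ V := by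
  intro v hv
  have := forall_mul_mem_of_rel hV (S.closed_translate hV hVH hb) ht
    (fun y hy => by rw [mul_comm]; exact hy) (v * a) (by
      change v * a * a ∈ V
      rwa [mul_assoc, S.aa, mul_one])
  rwa [mul_comm v a, ← mul_assoc] at this

end KleinExt

end Setting

/-! ### The subgroup attached to the basic set of b -/

namespace KleinExt

variable {G : Type*} [CommGroup G] [Finite G] {A : SchurRing G}
variable {H H₀ : Subgroup G} {n : ℕ} {a b : G}

open SchurRing

/-- The elements of `H₀` carrying `b` into its basic set form a subgroup `U₀`, and `U₀ × {1, b}` is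
closed. -/
theorem exists_bSubgroup (S : KleinExt H H₀ n a b) (hH : A.Closed (H : Set G)) :
    ∃ U₀ : Subgroup G, U₀ ≤ H₀ ∧ (∀ h ∈ H₀, h ∈ U₀ ↔ A.Rel b (h * b)) ∧
      A.Closed {g | g ∈ U₀ ∨ g * b ∈ U₀} := by
  set B := A.cls b with hB
  have hBc : A.Closed B := closed_cls b
  have hBH : ∀ v ∈ B, v ∈ H := fun v hv => hH hv S.b_mem
  set D := {h | h ∈ H₀ ∧ ¬ (h ∈ B ↔ h * b ∈ B)} with hD
  have hDc : A.Closed D := S.closed_xor_inside hBc hBH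
  -- B ∪ D will be U₀ × {1, b}: B misses the core, so D consists of the h outside B with hb in B.
  have hUc : A.Closed (B ∪ D) := hBc.union hDc
  have hBQ : ∀ h ∈ B, h ∉ A.core H₀ := fun h hh hq =>
    S.b_notMem (core_le H₀ (closed_core H₀ (Rel.symm hh) hq))
  have m0 : ∀ h ∈ H₀, (h ∈ B ∪ D ↔ h * b ∈ B) := by
    intro h hh
    constructor
    · rintro (k | ⟨-, k⟩)
      · by_contra hb
        exact hBQ h k (S.mem_core_of_xor_inside hBc hBH hh (by tauto))
      · by_contra hb
        have hhB : h ∈ B := by tauto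
        exact hBQ h hhB (S.mem_core_of_xor_inside hBc hBH hh k)
    · intro k
      by_cases hhB : h ∈ B
      · exact Or.inl hhB
      · exact Or.inr ⟨hh, by tauto⟩
  have m1 : ∀ h ∈ H₀, (h * b ∈ B ∪ D ↔ h * b ∈ B) := by
    intro h hh
    refine ⟨?_, Or.inl⟩
    rintro (k | ⟨k, -⟩)
    · exact k
    · exact absurd k (S.mul_b_notMem hh)
  have hbU : ∀ v ∈ B ∪ D, b * v ∈ B ∪ D := by
    intro v hv
    have hvH : v ∈ H := hv.elim (hBH v) (fun k => S.le k.1)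
    obtain ⟨h, hh, rfl | rfl⟩ := S.inside v hvH
    · rw [mul_comm, m1 v hh]
      exact (m0 v hh).1 hv
    · rw [mul_left_comm, S.bb, mul_one, m0 h hh]
      exact (m1 h hh).1 hv
  have hst : ∀ h ∈ H₀, h * b ∈ B → ∀ v ∈ B ∪ D, h * v ∈ B ∪ D := by
    intro h hh hhB v hv
    have := hUc.stab (g' := h * b) hhB hbU _ (hbU v hv)
    rwa [mul_assoc, ← mul_assoc b, S.bb, one_mul] at this
  let U₀ : Subgroup G :=
    { carrier := {h | h ∈ H₀ ∧ h * b ∈ B}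
      one_mem' := ⟨H₀.one_mem, by rw [one_mul]; exact mem_cls_self b⟩
      mul_mem' := by
        rintro x y ⟨hx, hxB⟩ ⟨hy, hyB⟩
        refine ⟨H₀.mul_mem hx hy, (m0 _ (H₀.mul_mem hx hy)).1 ?_⟩
        exact hst x hx hxB y ((m0 y hy).2 hyB)
      inv_mem' := by
        rintro x ⟨hx, hxB⟩
        refine ⟨H₀.inv_mem hx, ?_⟩
        have := Rel.inv hxB
        rwa [mul_inv, inv_eq_of_mul_eq_one_left S.bb] at this }
  refine ⟨U₀, fun h hh => hh.1, fun h hh => ⟨fun k => k.2, fun k => ⟨hh, k⟩⟩, ?_⟩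
  convert hUc using 1
  ext g
  constructor
  · rintro (k | k)
    · exact (m0 g k.1).2 k.2
    · have := hbU _ ((m0 _ k.1).2 k.2)
      rwa [mul_left_comm, S.bb, mul_one] at this
  · intro hg
    have hgH : g ∈ H := hg.elim (hBH g) (fun k => S.le k.1)
    obtain ⟨h, hh, rfl | rfl⟩ := S.inside g hgH
    · exact Or.inl ⟨hh, (m0 g hh).1 hg⟩
    · refine Or.inr ?_
      rw [mul_assoc, S.bb, mul_one]
      exact ⟨hh, (m1 h hh).1 hg⟩

/-- The part outside `H₀` of a closed subset of `H` is invariant under `U₀`. -/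
theorem rel_mul_b (S : KleinExt H H₀ n a b) (hH : A.Closed (H : Set G)) {U₀ : Subgroup G}
    (hU : U₀ ≤ H₀) (hUb : ∀ h ∈ H₀, h ∈ U₀ ↔ A.Rel b (h * b)) {x u : G} (hx : x ∈ H₀)
    (hu : u ∈ U₀) : A.Rel (x * b) (u * x * b) := by
  set V := A.cls (x * b) with hV
  have hVc : A.Closed V := closed_cls _
  have hVH : ∀ v ∈ V, v ∈ H := fun v hv => hH hv (H.mul_mem (S.le hx) S.b_mem)
  have hxV : x * b ∈ V := mem_cls_self _
  have hVQ : ∀ h ∈ V, h ∉ A.core H₀ := fun h hh hq =>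
    S.mul_b_notMem hx (core_le H₀ (closed_core H₀ (Rel.symm hh) hq))
  change u * x * b ∈ V
  have hub : A.Rel b (u * b) := (hUb u (hU hu)).1 hu
  -- If V contains yb with y in the core, then V contains the product of the basic sets of b and y,
  -- and that product visibly absorbs U₀. Otherwise V is b-invariant, so every ub related to b
  -- stabilizes it.
  by_cases hex : ∃ y ∈ A.core H₀, y * b ∈ V
  · obtain ⟨y, hyQ, hyV⟩ := hex
    have hDc := S.closed_xor_inside hVc hVH
    have hfull : ∀ g, A.Rel b g → ∀ z ∈ A.cls y, g * z ∈ V := by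
      intro g hg
      refine forall_mul_mem_of_rel hVc (closed_cls y) hg ?_
      intro z hz
      have hzQ : z ∈ A.core H₀ := closed_core H₀ hz hyQ
      have := hDc hz ⟨core_le H₀ hyQ, fun k => hVQ y (k.2 hyV) hyQ⟩
      by_contra hzV
      rw [mul_comm] at hzV
      exact this.2 ⟨fun k => absurd hzQ (hVQ z k), fun k => absurd k hzV⟩
    have hmul : A.Closed (A.cls b * A.cls y) := (closed_cls b).mul (closed_cls y)
    have : x * b ∈ A.cls b * A.cls y :=
      hmul (x := y * b) (Rel.symm hyV) ⟨b, mem_cls_self b, y, mem_cls_self y, mul_comm _ _⟩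
    obtain ⟨g, hg, z, hz, hgz⟩ := this
    have hzH : z ∈ H₀ := core_le H₀ (closed_core H₀ hz hyQ)
    have hge : g = x * z⁻¹ * b := by
      simp only at hgz
      rw [mul_right_comm, ← hgz, mul_inv_cancel_right]
    have hv : x * z⁻¹ ∈ H₀ := H₀.mul_mem hx (H₀.inv_mem hzH)
    have hvU : x * z⁻¹ ∈ U₀ := (hUb _ hv).2 (hge ▸ hg)
    have := hfull _ ((hUb _ (hU (U₀.mul_mem hu hvU))).1 (U₀.mul_mem hu hvU)) z hz
    convert this using 1
    rw [← mul_assoc u, mul_right_comm _ z⁻¹ b, mul_assoc _ z⁻¹ z, inv_mul_cancel, mul_one]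
  · have hbV : ∀ v ∈ V, b * v ∈ V := by
      intro v hv
      obtain ⟨h, hh, rfl | rfl⟩ := S.inside v (hVH v hv)
      · by_contra hcon
        rw [mul_comm] at hcon
        exact hVQ v hv (S.mem_core_of_xor_inside hVc hVH hh (by tauto))
      · rw [mul_left_comm, S.bb, mul_one]
        by_contra hcon
        exact hex ⟨h, S.mem_core_of_xor_inside hVc hVH hh (by tauto), hv⟩
    have := hVc.stab hub hbV _ (hbV _ hxV)
    rwa [mul_left_comm b, S.bb, mul_one, mul_right_comm] at this

theorem ncard_outside (S : KleinExt H H₀ n a b) {X : Set G} (hX : ∀ v ∈ X, v ∉ H) :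
    X.ncard = {h | h ∈ H₀ ∧ h * a ∈ X}.ncard + {h | h ∈ H₀ ∧ h * (a * b) ∈ X}.ncard := by
  have h1 : X = (fun h => h * a) '' {h | h ∈ H₀ ∧ h * a ∈ X} ∪
      (fun h => h * (a * b)) '' {h | h ∈ H₀ ∧ h * (a * b) ∈ X} := by
    ext v
    constructor
    · intro hv
      obtain ⟨h, hh, rfl | rfl⟩ := S.outside v (hX v hv)
      · exact Or.inl ⟨h, ⟨hh, hv⟩, rfl⟩
      · exact Or.inr ⟨h, ⟨hh, hv⟩, rfl⟩
    · rintro (⟨h, hh, rfl⟩ | ⟨h, hh, rfl⟩)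
      · exact hh.2
      · exact hh.2
  conv_lhs => rw [h1]
  rw [Set.ncard_union_eq, Set.ncard_image_of_injective _ (mul_left_injective a),
    Set.ncard_image_of_injective _ (mul_left_injective (a * b))]
  rw [Set.disjoint_left]
  rintro v ⟨h, hh, rfl⟩ ⟨h', hh', k⟩
  exact S.ne_ab hh.1 hh'.1 k.symm

/-- The correlation of the two halves of a closed set outside `H` is constant on `U₀`. -/
theorem ncard_correlation (S : KleinExt H H₀ n a b) {Z : Set G} (hZ : A.Closed Z)
    (hZH : ∀ v ∈ Z, v ∉ H) {u : G} (hu : u ∈ H₀) (hub : A.Rel b (u * b)) :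
    {h | h ∈ H₀ ∧ h * a ∈ Z ∧ u * h * (a * b) ∈ Z}.ncard +
      {h | h ∈ H₀ ∧ h * (a * b) ∈ Z ∧ u * h * a ∈ Z}.ncard =
    2 * {h | h ∈ H₀ ∧ h * a ∈ Z ∧ h * (a * b) ∈ Z}.ncard := by
  -- Multiplication by vb exchanges H₀a and H₀ab, so one structure constant of Z with itself is the
  -- sum of the two cross-correlations.
  have key : ∀ v ∈ H₀, {y | y ∈ Z ∧ v * b * y ∈ Z}.ncard =
      {h | h ∈ H₀ ∧ h * a ∈ Z ∧ v * h * (a * b) ∈ Z}.ncard +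
      {h | h ∈ H₀ ∧ h * (a * b) ∈ Z ∧ v * h * a ∈ Z}.ncard := by
    intro v hv
    rw [S.ncard_outside (fun y hy => hZH y hy.1)]
    have e1 : ∀ h : G, v * b * (h * a) = v * h * (a * b) := fun h => by
      simp only [mul_comm, mul_left_comm]
    have e2 : ∀ h : G, v * b * (h * (a * b)) = v * h * a := fun h => by
      calc v * b * (h * (a * b)) = v * h * a * (b * b) := by simp only [mul_comm, mul_left_comm]
        _ = _ := by rw [S.bb, mul_one]
    congr 2
    · ext h
      simp only [Set.mem_ofPred_eq, e1]
    · ext h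
      simp only [Set.mem_ofPred_eq, e2]
  have h1 := ncard_eq_of_rel hZ hZ hub
  rw [key u hu] at h1
  have h2 := key 1 H₀.one_mem
  simp only [one_mul] at h2
  rw [← h1, h2, two_mul]
  congr 2
  ext h
  simp only [Set.mem_ofPred_eq]
  tauto

end KleinExt

/-! ### Parity of inverse-closed subsets of H₀ -/

namespace KleinExt

section Parity

variable {G : Type*} [CommGroup G] [Finite G] {H H₀ : Subgroup G} {n : ℕ} {a b : G}

/-- Inversion on H₀ fixes only 1, since H₀ has no involutions. -/
theorem even_ncard (S : KleinExt H H₀ n a b) {Z : Set G} (hZ : ∀ z ∈ Z, z ∈ H₀ ∧ z⁻¹ ∈ Z)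
    (h1 : 1 ∉ Z) : Even Z.ncard := by
  classical
  have hs : ∑ z ∈ Z.toFinite.toFinset, (1 : ZMod 2) = 0 := by
    refine Finset.sum_involution (fun z _ => z⁻¹) ?_ ?_ ?_ ?_
    · intro z _; decide
    · intro z hz _ k
      simp only [Set.Finite.mem_toFinset] at hz
      have hz1 : z = 1 := S.eq_one_of_sq (hZ z hz).1 (by
        nth_rewrite 1 [← k]; exact inv_mul_cancel z)
      exact h1 (hz1 ▸ hz)
    · intro z hz
      simp only [Set.Finite.mem_toFinset] at hz ⊢
      exact (hZ z hz).2
    · intro z _; exact inv_inv z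
  rw [Finset.sum_const, nsmul_eq_mul, mul_one, ZMod.natCast_eq_zero_iff,
    ← Set.ncard_eq_toFinset_card] at hs
  exact even_iff_two_dvd.2 hs

theorem odd_ncard (S : KleinExt H H₀ n a b) {Z : Set G} (hZ : ∀ z ∈ Z, z ∈ H₀ ∧ z⁻¹ ∈ Z)
    (h1 : 1 ∈ Z) : Odd Z.ncard := by
  have := S.even_ncard (Z := Z \ {1}) (fun z hz => ⟨(hZ z hz.1).1, (hZ z hz.1).2, fun k =>
    hz.2 (inv_eq_one.1 k)⟩) (fun k => k.2 rfl)
  rw [← Set.ncard_sdiff_singleton_add_one h1]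
  exact this.add_one

end Parity

/-! ### The case where a and ab lie in different basic sets -/

section Separated

variable {G : Type*} [CommGroup G] [Finite G] {A : SchurRing G}
variable {H H₀ : Subgroup G} {n : ℕ} {a b : G}

open SchurRing

theorem cls_outside (S : KleinExt H H₀ n a b) (hH : A.Closed (H : Set G)) :
    ∀ v ∈ A.cls a, v ∉ H := fun _ hv k => S.a_notMem (hH (Rel.symm hv) k)

theorem rel_a_inv (S : KleinExt H H₀ n a b) {h : G} (k : A.Rel a (h * a)) :
    A.Rel a (h⁻¹ * a) := by
  have := k.inv
  rwa [mul_inv, S.inv_a] at this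

theorem rel_ab_inv (S : KleinExt H H₀ n a b) {h : G} (k : A.Rel a (h * (a * b))) :
    A.Rel a (h⁻¹ * (a * b)) := by
  have := k.inv
  rwa [mul_inv, S.inv_a, S.swap.inv_a] at this

/-- Count the y in the core that a, respectively qab, multiplies into the basic set T of a. The
first set is inverse-closed and contains 1, so it is odd. The second is a q-translate of an
inverse-closed set without 1, so it is even. Related elements would give equal counts. -/
theorem not_rel_core_mul_ab (S : KleinExt H H₀ n a b) (hab : ¬ A.Rel a (a * b)) {q : G}
    (hq : q ∈ A.core H₀) : ¬ A.Rel a (q * (a * b)) := by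
  intro hrel
  have key := ncard_eq_of_rel (closed_cls a) (closed_core (A := A) H₀) hrel
  have e : {y | y ∈ (A.core H₀ : Set G) ∧ q * (a * b) * y ∈ A.cls a} =
      (fun y => q⁻¹ * y) '' {y | y ∈ (A.core H₀ : Set G) ∧ y * (a * b) ∈ A.cls a} := by
    ext y
    constructor
    · rintro ⟨hy, hy'⟩
      refine ⟨q * y, ⟨(A.core H₀).mul_mem hq hy, ?_⟩, by simp⟩
      rwa [mul_right_comm]
    · rintro ⟨z, ⟨hz, hz'⟩, rfl⟩
      refine ⟨(A.core H₀).mul_mem ((A.core H₀).inv_mem hq) hz, ?_⟩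
      convert hz' using 1
      rw [mul_right_comm, mul_inv_cancel_left]
  rw [e, Set.ncard_image_of_injective _ (mul_right_injective _)] at key
  have h1 : Odd {y | y ∈ (A.core H₀ : Set G) ∧ a * y ∈ A.cls a}.ncard := by
    refine S.odd_ncard ?_ ⟨(A.core H₀).one_mem, by rw [mul_one]; exact mem_cls_self a⟩
    rintro z ⟨hz, hz'⟩
    refine ⟨core_le H₀ hz, (A.core H₀).inv_mem hz, ?_⟩
    rw [mul_comm] at hz' ⊢
    exact S.rel_a_inv hz'
  have h2 : Even {y | y ∈ (A.core H₀ : Set G) ∧ y * (a * b) ∈ A.cls a}.ncard := by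
    refine S.even_ncard ?_ (fun k => hab (by have := k.2; rwa [one_mul] at this))
    rintro z ⟨hz, hz'⟩
    exact ⟨core_le H₀ hz, (A.core H₀).inv_mem hz, S.rel_ab_inv hz'⟩
  rw [key] at h1
  exact (Nat.not_even_iff_odd.2 h1) h2

/-- If `a` and `a * b` lie in different basic sets, the basic set of `a` is invariant under all
`q` in the core of `H₀` with `q * a` related to `a`. -/
theorem rel_mul_of_core (S : KleinExt H H₀ n a b) (hH : A.Closed (H : Set G))
    (hab : ¬ A.Rel a (a * b)) {q t : G} (hq : q ∈ A.core H₀) (hqa : A.Rel a (q * a))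
    (ht : A.Rel a t) : A.Rel a (t * q) := by
  have hD := S.closed_xor_outside (closed_cls a) (S.cls_outside hH)
  refine forall_mul_mem_of_rel (closed_cls a) hD ht ?_ q ⟨core_le H₀ hq, fun k =>
    S.not_rel_core_mul_ab hab hq (k.1 hqa)⟩
  rintro y ⟨hy, hy'⟩
  have hyQ : y ∈ A.core H₀ := S.mem_core_of_xor_outside (closed_cls a) (S.cls_outside hH) hy hy'
  rw [mul_comm]
  by_contra hcon
  exact hy' ⟨fun k => absurd k hcon, fun k => absurd k (S.not_rel_core_mul_ab hab hyQ)⟩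

/-- Together with `exists_of_rel_mul` this makes the basic set of xa the product of those of a and
x. That basic set avoids core·ab, so its closed set of elements seen once contains x, hence the
whole basic set of x; thus az ~ xa for all z ~ x. -/
theorem rel_core_mul (S : KleinExt H H₀ n a b) (hH : A.Closed (H : Set G))
    (hab : ¬ A.Rel a (a * b)) {x t y : G} (hx : x ∈ A.core H₀) (ht : A.Rel a t)
    (hy : A.Rel x y) : A.Rel (x * a) (t * y) := by
  have hsub : ∀ z, A.Rel (x * a) z → ∃ t y, A.Rel a t ∧ A.Rel x y ∧ t * y = z := by
    intro z hz
    obtain ⟨t, ht, y, hy, h⟩ := ((closed_cls (A := A) a).mul (closed_cls (A := A) x)) hz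
      ⟨a, mem_cls_self a, x, mem_cls_self x, mul_comm _ _⟩
    exact ⟨t, y, ht, hy, h⟩
  have hno : ∀ q ∈ A.core H₀, ¬ A.Rel (x * a) (q * (a * b)) := by
    intro q hq hrel
    obtain ⟨t, y, ht, hy, h⟩ := hsub _ hrel
    have hyQ : y ∈ A.core H₀ := closed_core H₀ hy hx
    refine S.not_rel_core_mul_ab hab ((A.core H₀).mul_mem hq ((A.core H₀).inv_mem hyQ))
      (?_ : A.Rel a _)
    rw [mul_right_comm, ← h, mul_inv_cancel_right]
    exact ht
  have hZH : ∀ v ∈ A.cls (x * a), v ∉ H := fun v hv k =>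
    S.mul_a_notMem (core_le H₀ hx) (hH (Rel.symm hv) k)
  have hD := S.closed_xor_outside (closed_cls (A := A) (x * a)) hZH
  refine forall_mul_mem_of_rel (closed_cls (A := A) (x * a)) (closed_cls x) ht ?_ y hy
  intro z hz
  have hzQ : z ∈ A.core H₀ := closed_core H₀ hz hx
  have := hD hz ⟨core_le H₀ hx, fun k => hno x hx (k.1 (mem_cls_self _))⟩
  rw [mul_comm a z]
  by_contra hcon
  exact this.2 ⟨fun k => absurd k hcon, fun k => absurd k (hno z hzQ)⟩

theorem exists_of_rel_mul {x g z : G} (hz : A.Rel (x * g) z) :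
    ∃ t y, A.Rel g t ∧ A.Rel x y ∧ z = y * t := by
  obtain ⟨y, hy, t, ht, h⟩ := ((closed_cls (A := A) x).mul (closed_cls (A := A) g)) hz
      ⟨x, mem_cls_self x, g, mem_cls_self g, rfl⟩
  exact ⟨t, y, ht, hy, h.symm⟩

/-- Invariance of the two basic sets of `a` and `a * b` over `H₀ a` spreads to all basic sets. -/
theorem rel_of_invariant (S : KleinExt H H₀ n a b) (hH : A.Closed (H : Set G))
    (hab : ¬ A.Rel a (a * b)) {r : G}
    (h₁ : ∀ h ∈ H₀, A.Rel a (h * a) → A.Rel a (r * h * a))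
    (h₂ : ∀ h ∈ H₀, A.Rel (a * b) (h * a) → A.Rel (a * b) (r * h * a)) {h : G} (hh : h ∈ H₀) :
    A.Rel (h * a) (r * h * a) := by
  have hab' : ¬ A.Rel (a * b) (a * b * b) := by
    rw [S.ab_b]; exact fun k => hab k.symm
  have hZH : ∀ v ∈ A.cls (h * a), v ∉ H := fun v hv k =>
    S.mul_a_notMem hh (hH (Rel.symm hv) k)
  have split : ∀ y t : G, y ∈ H₀ → h * a = y * t → t = (h * y⁻¹) * a := by
    intro y t _ k
    rw [mul_right_comm, k, mul_comm y t, mul_inv_cancel_right]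
  -- A basic set meeting core·a or core·ab is a product of a basic set inside the core with that of
  -- a or ab, and inherits their invariance. One meeting neither is b-invariant, and `translate_mem`
  -- applies because ra ~ a.
  by_cases e1 : ∃ x ∈ A.core H₀, A.Rel (h * a) (x * a)
  · obtain ⟨x, hx, hrel⟩ := e1
    obtain ⟨t, y, ht, hy, hty⟩ := exists_of_rel_mul hrel.symm
    have hyH : y ∈ H₀ := core_le H₀ (closed_core H₀ hy hx)
    have hte := split y t hyH hty
    rw [hte] at ht
    have := S.rel_core_mul hH hab hx (h₁ _ (H₀.mul_mem hh (H₀.inv_mem hyH)) ht) hy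
    refine hrel.trans ?_
    convert this using 1
    simp [mul_comm, mul_left_comm]
  by_cases e2 : ∃ x ∈ A.core H₀, A.Rel (h * a) (x * (a * b))
  · obtain ⟨x, hx, hrel⟩ := e2
    obtain ⟨t, y, ht, hy, hty⟩ := exists_of_rel_mul hrel.symm
    have hyH : y ∈ H₀ := core_le H₀ (closed_core H₀ hy hx)
    have hte := split y t hyH hty
    rw [hte] at ht
    have := S.swap.rel_core_mul hH hab' hx (h₂ _ (H₀.mul_mem hh (H₀.inv_mem hyH)) ht) hy
    refine hrel.trans ?_
    convert this using 1
    simp [mul_comm, mul_left_comm]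
  · have hb : ∀ v ∈ A.cls (h * a), v * b ∈ A.cls (h * a) := by
      intro v hv
      obtain ⟨k, hk, rfl | rfl⟩ := S.outside v (hZH v hv)
      · rw [mul_assoc]
        by_contra hcon
        exact e1 ⟨k, S.mem_core_of_xor_outside (closed_cls _) hZH hk (by tauto), hv⟩
      · rw [mul_assoc, S.ab_b]
        by_contra hcon
        exact e2 ⟨k, S.mem_core_of_xor_outside (closed_cls _) hZH hk (by tauto), hv⟩
    have hra : A.Rel a (r * a) := by
      have := h₁ 1 H₀.one_mem (by rw [one_mul]; exact Rel.refl a)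
      rwa [mul_one] at this
    have := S.translate_mem (closed_cls _) hZH hb hra _ (mem_cls_self _)
    rwa [mul_assoc r, S.aa, mul_one, ← mul_assoc] at this

/-- Let W be the set of h with hab in the basic set of a; then Wa lies there too, so the correlation
equals 2|W|. Each of its two terms is at most |W|, hence both are equal to |W|. -/
theorem rel_bSubgroup_mul (S : KleinExt H H₀ n a b) (hH : A.Closed (H : Set G))
    (hab : ¬ A.Rel a (a * b)) {u w : G} (hu : u ∈ H₀) (hub : A.Rel b (u * b))
    (hw : w ∈ H₀) (haw : A.Rel a (w * (a * b))) : A.Rel a (u * w * a) := by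
  have key := S.ncard_correlation (closed_cls a) (S.cls_outside hH) hu hub
  set W : Set G := {h | h ∈ H₀ ∧ h * (a * b) ∈ A.cls a} with hW
  have hWa : ∀ h ∈ W, h * a ∈ A.cls a := by
    rintro h ⟨hh, k⟩
    by_contra hcon
    exact S.not_rel_core_mul_ab hab
      (S.mem_core_of_xor_outside (closed_cls a) (S.cls_outside hH) hh (by tauto)) k
  have e0 : {h | h ∈ H₀ ∧ h * a ∈ A.cls a ∧ h * (a * b) ∈ A.cls a} = W := by
    ext h
    exact ⟨fun k => ⟨k.1, k.2.2⟩, fun k => ⟨k.1, hWa h k, k.2⟩⟩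
  have i1 : {h | h ∈ H₀ ∧ h * a ∈ A.cls a ∧ u * h * (a * b) ∈ A.cls a}.ncard ≤ W.ncard := by
    refine Set.ncard_le_ncard_of_injOn (fun h => u * h) ?_ (mul_right_injective u).injOn
    rintro h ⟨hh, -, k⟩
    exact ⟨H₀.mul_mem hu hh, k⟩
  have s2 : {h | h ∈ H₀ ∧ h * (a * b) ∈ A.cls a ∧ u * h * a ∈ A.cls a} ⊆ W :=
    fun h k => ⟨k.1, k.2.1⟩
  rw [e0] at key
  have := Set.eq_of_subset_of_ncard_le s2 (by omega)
  have hwW : w ∈ W := ⟨hw, haw⟩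
  rw [← this] at hwW
  exact hwW.2.2

/-- If no such u existed, both U₀wa and U₀wab would lie in the basic set of a. Since wa ~ a, the
closed set U₀ × {1, b} translated by a would lie there as well, giving a ~ ab. -/
theorem exists_core_of_rel_ab (S : KleinExt H H₀ n a b) (hH : A.Closed (H : Set G))
    (hab : ¬ A.Rel a (a * b)) {U₀ : Subgroup G} (hU : U₀ ≤ H₀)
    (hUb : ∀ h ∈ H₀, h ∈ U₀ ↔ A.Rel b (h * b)) (hUc : A.Closed {g | g ∈ U₀ ∨ g * b ∈ U₀})
    {w : G} (hw : w ∈ H₀) (haw : A.Rel a (w * (a * b))) :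
    ∃ u ∈ U₀, u * w ∈ A.core H₀ ∧ A.Rel a (u * w * a) := by
  by_contra hcon
  push Not at hcon
  have h1 : ∀ u ∈ U₀, A.Rel a (u * w * a) := fun u hu =>
    S.rel_bSubgroup_mul hH hab (hU hu) ((hUb u (hU hu)).1 hu) hw haw
  have h2 : ∀ u ∈ U₀, A.Rel a (u * w * (a * b)) := by
    intro u hu
    by_contra hc
    refine hcon u hu (S.mem_core_of_xor_outside (closed_cls a) (S.cls_outside hH)
      (H₀.mul_mem (hU hu) hw) (fun k => hc (k.1 (h1 u hu)))) (h1 u hu)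
  have hwa : A.Rel (w * a) a := by
    have := h1 1 U₀.one_mem
    rw [one_mul] at this
    exact this.symm
  have := forall_mul_mem_of_rel (closed_cls a) hUc hwa ?_ b
    (Or.inr (by rw [S.bb]; exact U₀.one_mem))
  · exact hab this
  · rintro y (hy | hy)
    · have := h1 y hy
      rwa [mul_assoc, mul_comm] at this
    · have := h2 _ hy
      have e : y * b * w * (a * b) = w * a * y := by
        calc y * b * w * (a * b) = w * a * y * (b * b) := by simp only [mul_comm, mul_left_comm]
          _ = _ := by rw [S.bb, mul_one]
      rwa [e] at this

/-- If the basic set of `a` meets `H₀ a b`, then it is invariant over `H₀ a` under `U₀`, while the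
basic set of `a * b` is contained in `J a b` with `J a` the core part of the basic set of `a`. -/
theorem rel_of_meets (S : KleinExt H H₀ n a b) (hH : A.Closed (H : Set G))
    (hab : ¬ A.Rel a (a * b)) {U₀ : Subgroup G} (hU : U₀ ≤ H₀)
    (hUb : ∀ h ∈ H₀, h ∈ U₀ ↔ A.Rel b (h * b)) (hUc : A.Closed {g | g ∈ U₀ ∨ g * b ∈ U₀})
    {w : G} (hw : w ∈ H₀) (haw : A.Rel a (w * (a * b))) :
    (∃ u ∈ U₀, u ≠ 1) ∧ (∀ u ∈ U₀, ∀ h ∈ H₀, A.Rel a (h * a) → A.Rel a (u * h * a)) ∧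
      ∀ z, A.Rel (a * b) z → ∃ j ∈ A.core H₀, A.Rel a (j * a) ∧ z = j * (a * b) := by
  obtain ⟨u, hu, huQ, hua⟩ := S.exists_core_of_rel_ab hH hab hU hUb hUc hw haw
  have hJinv : ∀ j ∈ A.core H₀, A.Rel a (j * a) → ∀ t, A.Rel a t → A.Rel a (t * j) :=
    fun j hj hja t ht => S.rel_mul_of_core hH hab hj hja ht
  have hu' : A.Rel a (u⁻¹ * (a * b)) := by
    have := hJinv _ ((A.core H₀).inv_mem huQ) (S.rel_a_inv hua) _ haw
    convert this using 1
    rw [mul_inv, mul_right_comm, mul_left_comm w, mul_inv_cancel, mul_one]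
  have hUa : ∀ v ∈ U₀, A.Rel a (v * a) := by
    intro v hv
    have hvu := U₀.mul_mem hv hu
    have := S.rel_bSubgroup_mul hH hab (hU hvu) ((hUb _ (hU hvu)).1 hvu)
      (H₀.inv_mem (hU hu)) hu'
    rwa [mul_inv_cancel_right] at this
  -- With J the set of core elements j such that ja ~ a, the part of T in H₀a is U₀Ja.
  have hdec : ∀ h ∈ H₀, A.Rel a (h * a) →
      ∃ v ∈ U₀, ∃ j ∈ A.core H₀, A.Rel a (j * a) ∧ h = v * j := by
    intro h hh hha
    by_cases hhQ : h ∈ A.core H₀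
    · exact ⟨1, U₀.one_mem, h, hhQ, hha, (one_mul h).symm⟩
    · have : A.Rel a (h * (a * b)) := by
        by_contra hc
        exact hhQ (S.mem_core_of_xor_outside (closed_cls a) (S.cls_outside hH) hh
          (fun k => hc (k.1 hha)))
      obtain ⟨v, hv, hvQ, hva⟩ := S.exists_core_of_rel_ab hH hab hU hUb hUc hh this
      exact ⟨v⁻¹, U₀.inv_mem hv, v * h, hvQ, hva, by simp⟩
  have hUJ : ∀ v ∈ U₀, ∀ j ∈ A.core H₀, A.Rel a (j * a) → A.Rel a (v * j * a) := by
    intro v hv j hj hja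
    have := hJinv j hj hja _ (hUa v hv)
    rwa [mul_right_comm] at this
  have hWa : ∀ h ∈ H₀, A.Rel a (h * (a * b)) → A.Rel a (h * a) := by
    intro h hh k
    by_contra hc
    exact S.not_rel_core_mul_ab hab
      (S.mem_core_of_xor_outside (closed_cls a) (S.cls_outside hH) hh (fun e => hc (e.2 k))) k
  refine ⟨⟨u, hu, ?_⟩, ?_, ?_⟩
  · rintro rfl
    rw [one_mul] at huQ
    exact S.not_rel_core_mul_ab hab huQ haw
  · intro v hv h hh hha
    obtain ⟨v', hv', j, hj, hja, rfl⟩ := hdec h hh hha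
    rw [← mul_assoc v]
    exact hUJ _ (U₀.mul_mem hv hv') j hj hja
  · intro z hz
    -- The basic set of ab lies in U₀{1, b}T \ T. Removing T removes all of U₀Ja, and a remaining
    -- kab has ka in T but kab outside T, which puts k in the core.
    have hclosed : A.Closed (({g | g ∈ U₀ ∨ g * b ∈ U₀} * A.cls a) \ A.cls a) :=
      (hUc.mul (closed_cls a)).diff (closed_cls a)
    have hmem : a * b ∈ ({g | g ∈ U₀ ∨ g * b ∈ U₀} * A.cls a) \ A.cls a :=
      ⟨⟨b, Or.inr (by rw [S.bb]; exact U₀.one_mem), a, mem_cls_self a, mul_comm _ _⟩, hab⟩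
    obtain ⟨⟨g, hg, t, ht, rfl⟩, hnot⟩ := hclosed hz hmem
    have hsplit : ∃ k ∈ H₀, (∃ v ∈ U₀, ∃ j ∈ A.core H₀, A.Rel a (j * a) ∧ k = v * j) ∧
        (g * t = k * a ∨ g * t = k * (a * b)) := by
      obtain ⟨h, hh, hth⟩ := S.outside t (S.cls_outside hH t ht)
      have hha : A.Rel a (h * a) := by
        rcases hth with rfl | rfl
        · exact ht
        · exact hWa h hh ht
      obtain ⟨v, hv, j, hj, hja, rfl⟩ := hdec h hh hha
      have hjH := core_le H₀ hj
      rcases hg with hg | hg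
      · refine ⟨g * v * j, H₀.mul_mem (hU (U₀.mul_mem hg hv)) hjH,
          ⟨g * v, U₀.mul_mem hg hv, j, hj, hja, rfl⟩, ?_⟩
        rcases hth with rfl | rfl
        · left; simp only [mul_assoc]
        · right; simp only [mul_assoc]
      · refine ⟨g * b * v * j, H₀.mul_mem (hU (U₀.mul_mem hg hv)) hjH,
          ⟨g * b * v, U₀.mul_mem hg hv, j, hj, hja, rfl⟩, ?_⟩
        rcases hth with rfl | rfl
        · right
          calc g * (v * j * a) = g * (v * j * a) * (b * b) := by rw [S.bb, mul_one]
            _ = _ := by simp only [mul_comm, mul_left_comm]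
        · left; simp only [mul_comm, mul_left_comm]
    obtain ⟨k, hk, ⟨v, hv, j, hj, hja, rfl⟩, hgt⟩ := hsplit
    have hka := hUJ v hv j hj hja
    rcases hgt with e | e
    · exact absurd (by simp only [e]; exact hka) hnot
    · simp only [e] at hnot ⊢
      refine ⟨v * j, ?_, hka, rfl⟩
      exact S.mem_core_of_xor_outside (closed_cls a) (S.cls_outside hH) hk
        (fun i => hnot (i.1 hka))

theorem exists_radical_of_not_rel (S : KleinExt H H₀ n a b) (hH : A.Closed (H : Set G))
    (hab : ¬ A.Rel a (a * b)) (ha : A.cls a ≠ {a}) :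
    ∃ r ∈ H₀, r ≠ 1 ∧ ∀ h ∈ H₀, A.Rel (h * a) (r * h * a) := by
  obtain ⟨U₀, hU, hUb, hUc⟩ := S.exists_bSubgroup hH
  have hab' : ¬ A.Rel (a * b) (a * b * b) := by
    rw [S.ab_b]; exact fun k => hab k.symm
  by_cases hW : ∃ w ∈ H₀, A.Rel a (w * (a * b))
  · obtain ⟨w, hw, haw⟩ := hW
    obtain ⟨⟨u, hu, hu1⟩, hinv, hT'⟩ := S.rel_of_meets hH hab hU hUb hUc hw haw
    refine ⟨u, hU hu, hu1, fun h hh => S.rel_of_invariant hH hab (hinv u hu) ?_ hh⟩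
    intro k hk hrel
    obtain ⟨j, hj, -, e⟩ := hT' _ hrel
    exact absurd e (S.ne_ab hk (core_le H₀ hj))
  · have hT : ∀ z, A.Rel a z → ∃ j ∈ A.core H₀, z = j * a := by
      intro z hz
      obtain ⟨h, hh, rfl | rfl⟩ := S.outside z (S.cls_outside hH z hz)
      · refine ⟨h, ?_, rfl⟩
        exact S.mem_core_of_xor_outside (closed_cls a) (S.cls_outside hH) hh
          (fun k => hW ⟨h, hh, k.1 hz⟩)
      · exact absurd ⟨h, hh, hz⟩ hW
    have : ∃ z, A.Rel a z ∧ z ≠ a := by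
      by_contra hcon
      push Not at hcon
      apply ha
      ext z
      exact ⟨fun k => hcon z k, fun k => by rw [k]; exact mem_cls_self a⟩
    obtain ⟨z, hz, hza⟩ := this
    obtain ⟨j, hj, rfl⟩ := hT z hz
    have hj1 : j ≠ 1 := by rintro rfl; exact hza (one_mul a)
    refine ⟨j, core_le H₀ hj, hj1, fun h hh => S.rel_of_invariant hH hab ?_ ?_ hh⟩
    · intro k _ hrel
      have := S.rel_mul_of_core hH hab hj hz hrel
      rwa [mul_comm, ← mul_assoc] at this
    -- If the basic set of ab meets H₀a, exchanging a and ab in `rel_of_meets` shows jab ~ ab with j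
    -- in the core, so j preserves that basic set.
    · intro k hk hrel
      have hrel' : A.Rel (a * b) (k * (a * b * b)) := by rwa [S.ab_b]
      obtain ⟨-, -, hT'⟩ := S.swap.rel_of_meets hH hab' hU hUb hUc hk hrel'
      rw [S.ab_b] at hT'
      obtain ⟨j', hj', hrj', e⟩ := hT' _ hz
      have hjj : j = j' := mul_right_cancel e
      subst hjj
      have := S.swap.rel_mul_of_core hH hab' hj' hrj' hrel
      rwa [mul_comm _ j, ← mul_assoc] at this

end Separated

end KleinExt

namespace KleinExt

/-! ### The case a ~ ab with {b} a basic set -/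

section Linked

variable {G : Type*} [CommGroup G] [Finite G] {A : SchurRing G}
variable {H H₀ : Subgroup G} {n : ℕ} {a b : G}

open SchurRing

theorem rel_mul_right {g : G} (hg : A.cls g = {g}) {x y : G} (h : A.Rel x y) :
    A.Rel (x * g) (y * g) := by
  have hx : A.Rel (g⁻¹ * (x * g)) y := by rwa [mul_comm x g, inv_mul_cancel_left]
  obtain ⟨t, v, ht, hv, e⟩ := exists_of_rel_mul hx
  have hv' : v⁻¹ ∈ A.cls g := by
    have := hv.inv
    rwa [inv_inv] at this
  rw [hg] at hv'
  have : t = y * g := by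
    rw [e, ← show v⁻¹ = g from hv', mul_comm, inv_mul_cancel_left]
  rwa [this] at ht

/-- The case where `a` and `a * b` are related and `{b}` is a basic set. -/
theorem exists_radical_of_cls_b (S : KleinExt H H₀ n a b) (hH : A.Closed (H : Set G))
    (hab : A.Rel a (a * b)) (hb : A.cls b = {b}) (ha : A.cls a ≠ {a, a * b}) :
    ∃ r ∈ H₀, r ≠ 1 ∧ ∀ h ∈ H₀, A.Rel (h * a) (r * h * a) := by
  have hTb : ∀ v ∈ A.cls a, v * b ∈ A.cls a := fun v hv => hab.trans (rel_mul_right hb hv)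
  have hTH := S.cls_outside hH
  have hTc := S.closed_translate (closed_cls a) hTH hTb
  let K : Subgroup G :=
    { carrier := {k | k ∈ H₀ ∧ A.Rel a (k * a)}
      one_mem' := ⟨H₀.one_mem, by rw [one_mul]; exact Rel.refl a⟩
      mul_mem' := by
        rintro x y ⟨hx, hxa⟩ ⟨hy, hya⟩
        refine ⟨H₀.mul_mem hx hy, ?_⟩
        have := S.translate_mem (closed_cls a) hTH hTb hxa _ hya
        rwa [mul_assoc x, S.aa, mul_one, ← mul_assoc] at this
      inv_mem' := by
        rintro x ⟨hx, hxa⟩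
        exact ⟨H₀.inv_mem hx, S.rel_a_inv hxa⟩ }
  have hKab : ∀ k ∈ K, A.Rel a (k * (a * b)) := fun k hk => by
    have := hTb _ hk.2
    rwa [mul_assoc] at this
  obtain ⟨k, hk, hk1⟩ : ∃ k ∈ K, k ≠ 1 := by
    by_contra hcon
    push Not at hcon
    apply ha
    ext z
    constructor
    · intro hz
      obtain ⟨h, hh, rfl | rfl⟩ := S.outside z (hTH z hz)
      · left; rw [hcon h ⟨hh, hz⟩, one_mul]
      · right
        have hz' : A.Rel a (h * a) := by
          have := hTb _ hz
          rwa [mul_assoc, S.ab_b] at this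
        rw [hcon h ⟨hh, hz'⟩, one_mul]; rfl
    · rintro (rfl | rfl)
      · exact mem_cls_self _
      · exact hab
  refine ⟨k, hk.1, hk1, fun h hh => ?_⟩
  set V := A.cls (h * a) with hV
  have hVc : A.Closed V := closed_cls _
  have hVH : ∀ v ∈ V, v ∉ H := fun v hv i => S.mul_a_notMem hh (hH (Rel.symm hv) i)
  by_cases hVb : ∃ v ∈ V, v * b ∈ V
  · obtain ⟨v, hv, hvb⟩ := hVb
    have hbV : ∀ w ∈ V, w * b ∈ V := fun w hw =>
      Rel.trans hvb (rel_mul_right hb (Rel.trans (Rel.symm hv) hw))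
    have := S.translate_mem hVc hVH hbV hk.2 _ (mem_cls_self _)
    rwa [mul_assoc k, S.aa, mul_one, ← mul_assoc] at this
  · push Not at hVb
    have hVb1 : ∀ x, x * a ∈ V → x * (a * b) ∉ V := fun x hx => by
      have := hVb _ hx
      rwa [mul_assoc] at this
    set D := {x | x ∈ H₀ ∧ ¬ (x * a ∈ V ↔ x * (a * b) ∈ V)} with hD
    have hDc : A.Closed D := S.closed_xor_outside hVc hVH
    have hDQ : D ⊆ A.core H₀ := hDc.subset_core (fun x hx => hx.1)
    have hhD : h ∈ D := ⟨hh, fun i => hVb1 h (mem_cls_self _) (i.1 (mem_cls_self _))⟩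
    -- D is the projection of V to H₀, injective on V because V is disjoint from Vb. For t in K both
    -- ta and tab are related to a, so the sum does not depend on t; at t = 1 it is |D|, which
    -- forces tD = D.
    have hcount : ∀ t ∈ H₀, {y | y ∈ D ∧ t * a * y ∈ V}.ncard +
        {y | y ∈ D ∧ t * (a * b) * y ∈ V}.ncard = {y | y ∈ D ∧ t * y ∈ D}.ncard := by
      intro t ht
      rw [← Set.ncard_union_eq]
      · congr 1
        ext y
        constructor
        · rintro (⟨hy, i⟩ | ⟨hy, i⟩)
          · rw [mul_right_comm] at i
            exact ⟨hy, H₀.mul_mem ht hy.1, fun j => hVb1 _ i (j.1 i)⟩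
          · rw [mul_right_comm] at i
            exact ⟨hy, H₀.mul_mem ht hy.1, fun j => hVb1 _ (j.2 i) i⟩
        · rintro ⟨hy, hty⟩
          by_cases i : t * y * a ∈ V
          · left; exact ⟨hy, by rwa [mul_right_comm]⟩
          · right; refine ⟨hy, ?_⟩
            rw [mul_right_comm]
            by_contra j
            exact hty.2 ⟨fun e => absurd e i, fun e => absurd e j⟩
      · rw [Set.disjoint_left]
        rintro y ⟨hy, i⟩ ⟨-, j⟩
        rw [mul_right_comm] at i j
        exact hVb1 _ i j
    have hKD : ∀ t ∈ K, ∀ y ∈ D, t * y ∈ D := by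
      intro t ht
      have h1 := hcount t ht.1
      have h2 := hcount 1 H₀.one_mem
      simp only [one_mul] at h2
      rw [← ncard_eq_of_rel hVc hDc ht.2,
        ← ncard_eq_of_rel hVc hDc (hab.symm.trans (hKab t ht)), h2] at h1
      have e : {y | y ∈ D ∧ y ∈ D} = D := by ext y; simp
      rw [e] at h1
      have := Set.eq_of_subset_of_ncard_le (s := {y | y ∈ D ∧ t * y ∈ D}) (t := D)
        (fun y i => i.1) h1.le
      intro y hy
      rw [← this] at hy
      exact hy.2
    have hKQ : ∀ t ∈ K, t ∈ A.core H₀ := fun t ht =>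
      ((A.core H₀).mul_mem_cancel_right (hDQ hhD)).1 (hDQ (hKD t ht h hhD))
    have hKc : A.Closed (K : Set G) := by
      have : (K : Set G) = {g | g * a ∈ A.cls a} ∩ A.core H₀ := by
        ext g
        exact ⟨fun i => ⟨i.2, hKQ g i⟩, fun i => ⟨core_le H₀ i.2, i.1⟩⟩
      rw [this]
      exact hTc.inter (closed_core H₀)
    -- K is now closed and Kh lies in D. If kha were outside V, then khab would be in V, and equal
    -- structure constants would make the numbers of y in K with hay in V and with haby in V equal.
    -- They add up to |K|, which is odd.
    by_contra hcon
    have hcon' : k * h * a ∉ V := hcon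
    have hkV : k * h * (a * b) ∈ V := by
      by_contra j
      exact (hKD k hk h hhD).2 ⟨fun e => absurd e hcon', fun e => absurd e j⟩
    have hc := ncard_eq_of_rel hVc hKc hkV
    have e1 : {y | y ∈ (K : Set G) ∧ k * h * (a * b) * y ∈ V} =
        (fun y => k⁻¹ * y) '' {y | y ∈ (K : Set G) ∧ h * (a * b) * y ∈ V} := by
      ext y
      constructor
      · rintro ⟨hy, i⟩
        refine ⟨k * y, ⟨K.mul_mem hk hy, ?_⟩, by simp⟩
        convert i using 1
        rw [← mul_assoc, mul_comm _ k]; simp only [mul_assoc]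
      · rintro ⟨z, ⟨hz, i⟩, rfl⟩
        refine ⟨K.mul_mem (K.inv_mem hk) hz, ?_⟩
        convert i using 1
        rw [← mul_assoc _ k⁻¹, mul_assoc k, mul_comm k, mul_inv_cancel_right]
    rw [e1, Set.ncard_image_of_injective _ (mul_right_injective _)] at hc
    have hsum : {y | y ∈ (K : Set G) ∧ h * a * y ∈ V}.ncard +
        {y | y ∈ (K : Set G) ∧ h * (a * b) * y ∈ V}.ncard = (K : Set G).ncard := by
      rw [← Set.ncard_union_eq]
      · congr 1
        ext y
        constructor
        · rintro (⟨hy, -⟩ | ⟨hy, -⟩) <;> exact hy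
        · intro hy
          have hyD := hKD y hy h hhD
          by_cases i : y * h * a ∈ V
          · left; refine ⟨hy, ?_⟩
            rwa [mul_comm, ← mul_assoc]
          · right; refine ⟨hy, ?_⟩
            rw [mul_comm, ← mul_assoc]
            by_contra j
            exact hyD.2 ⟨fun e => absurd e i, fun e => absurd e j⟩
      · rw [Set.disjoint_left]
        rintro y ⟨hy, i⟩ ⟨-, j⟩
        rw [mul_right_comm] at i j
        exact hVb1 _ i j
    have hodd : Odd (K : Set G).ncard :=
      S.odd_ncard (fun z hz => ⟨hz.1, K.inv_mem hz⟩) K.one_mem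
    rw [← hsum, hc, ← two_mul] at hodd
    exact Nat.not_odd_iff_even.2 (even_two_mul _) hodd

end Linked

end KleinExt

/-! ### A rigidity statement for correlations -/

/-- Rigidity of a pair of sets whose intersection with each coset of `P` is at most a point (on the
set `s`) or everything (off `s`), given constancy of their correlations on `P`. -/
theorem notMem_of_correlation {G : Type*} [CommGroup G] [Finite G] {P : Subgroup G} {s : Set G}
    {Z₀ Z₁ : Set G} (hs : ∀ l ∈ P, ∀ h, l * h ∈ s ↔ h ∈ s)
    (single₀ : ∀ h ∈ s, h ∈ Z₀ → ∀ l ∈ P, l * h ∈ Z₀ → l = 1)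
    (single₁ : ∀ h ∈ s, h ∈ Z₁ → ∀ l ∈ P, l * h ∈ Z₁ → l = 1)
    (full₀ : ∀ h ∉ s, h ∈ Z₀ → ∀ l ∈ P, l * h ∈ Z₀)
    (full₁ : ∀ h ∉ s, h ∈ Z₁ → ∀ l ∈ P, l * h ∈ Z₁)
    (corr₀ : ∀ l ∈ P, {y | ¬ (y ∈ Z₀ ↔ y ∈ Z₁) ∧ l * y ∈ Z₀}.ncard =
      {y | ¬ (y ∈ Z₀ ↔ y ∈ Z₁) ∧ y ∈ Z₀}.ncard)
    (corr₁ : ∀ l ∈ P, {y | ¬ (y ∈ Z₀ ↔ y ∈ Z₁) ∧ l * y ∈ Z₁}.ncard =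
      {y | ¬ (y ∈ Z₀ ↔ y ∈ Z₁) ∧ y ∈ Z₁}.ncard)
    (corr : ∀ l ∈ P, {h | h ∈ Z₀ ∧ l * h ∈ Z₁}.ncard + {h | h ∈ Z₁ ∧ l * h ∈ Z₀}.ncard =
      2 * {h | h ∈ Z₀ ∧ h ∈ Z₁}.ncard)
    {l : G} (hl : l ∈ P) (hl1 : l ≠ 1) (hl2 : l * l ≠ 1) {h : G} (hh : h ∈ Z₀) : h ∉ s := by
  have main : ∀ Z W : Set G,
      (∀ h ∈ s, h ∈ Z → ∀ l ∈ P, l * h ∈ Z → l = 1) →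
      (∀ h ∈ s, h ∈ W → ∀ l ∈ P, l * h ∈ W → l = 1) →
      (∀ h ∉ s, h ∈ Z → ∀ l ∈ P, l * h ∈ Z) → (∀ h ∉ s, h ∈ W → ∀ l ∈ P, l * h ∈ W) →
      (∀ l ∈ P, {y | ¬ (y ∈ Z ↔ y ∈ W) ∧ l * y ∈ Z}.ncard =
        {y | ¬ (y ∈ Z ↔ y ∈ W) ∧ y ∈ Z}.ncard) →
      ∀ x ∈ s, x ∈ Z → x ∈ W := by
    intro Z W sZ sW fZ fW cZ x hx hxZ
    by_contra hxW
    -- Multiplication by l embeds one side of the correlation hypothesis `cZ` in the other. Equal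
    -- cardinalities make it onto, and the preimage of x must lie in W but not in Z.
    have step : ∀ l ∈ P, l ≠ 1 → l⁻¹ * x ∈ W := by
      intro l hl hl1
      have hsub : (fun y => l * y) '' {y | ¬ (y ∈ Z ↔ y ∈ W) ∧ l * y ∈ Z} ⊆
          {y | ¬ (y ∈ Z ↔ y ∈ W) ∧ y ∈ Z} := by
        rintro _ ⟨y, ⟨hy, hly⟩, rfl⟩
        refine ⟨?_, hly⟩
        by_cases hys : y ∈ s
        · have hyZ : y ∉ Z := fun k => hl1 (sZ y hys k l hl hly)
          have hyW : y ∈ W := by tauto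
          exact fun k => hl1 (sW y hys hyW l hl (k.1 hly))
        · have hlys : l * y ∉ s := fun k => hys ((hs l hl y).1 k)
          have hyZ : y ∈ Z := by
            have := fZ _ hlys hly l⁻¹ (P.inv_mem hl)
            rwa [inv_mul_cancel_left] at this
          intro k
          have := fW _ hlys (k.1 hly) l⁻¹ (P.inv_mem hl)
          rw [inv_mul_cancel_left] at this
          exact hy ⟨fun _ => this, fun _ => hyZ⟩
      have heq := Set.eq_of_subset_of_ncard_le hsub (by
        rw [Set.ncard_image_of_injective _ (mul_right_injective l), cZ l hl])
      have hxm : x ∈ {y | ¬ (y ∈ Z ↔ y ∈ W) ∧ y ∈ Z} := ⟨fun k => hxW (k.1 hxZ), hxZ⟩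
      rw [← heq] at hxm
      obtain ⟨y, ⟨hy, hly⟩, hyx⟩ := hxm
      simp only at hyx
      subst hyx
      rw [inv_mul_cancel_left]
      have hys : y ∈ s := (hs l hl y).1 hx
      have hyZ : y ∉ Z := fun k => hl1 (sZ y hys k l hl hly)
      tauto
    -- Both l⁻¹x and lx lie in W and differ by l² ≠ 1, against singleness on s.
    have h1 := step l hl hl1
    have h2 := step l⁻¹ (P.inv_mem hl) (inv_ne_one.2 hl1)
    have h3 := sW _ ((hs l⁻¹ (P.inv_mem hl) x).2 hx) h1 (l * l) (P.mul_mem hl hl) (by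
      rwa [mul_assoc, mul_inv_cancel_left, ← inv_inv l])
    exact hl2 h3
  have e01 := main Z₀ Z₁ single₀ single₁ full₀ full₁ corr₀
  have e10 := main Z₁ Z₀ single₁ single₀ full₁ full₀ (fun l hl => by
    simpa only [iff_comm] using corr₁ l hl)
  intro hhs
  have s1 : {h | h ∈ Z₀ ∧ l * h ∈ Z₁} ⊆ {h | h ∈ Z₀ ∧ h ∈ Z₁} := by
    rintro y ⟨hy, hly⟩
    refine ⟨hy, ?_⟩
    by_cases hys : y ∈ s
    · exact e01 y hys hy
    · have := full₁ _ (fun k => hys ((hs l hl y).1 k)) hly l⁻¹ (P.inv_mem hl)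
      rwa [inv_mul_cancel_left] at this
  have s2 : {h | h ∈ Z₁ ∧ l * h ∈ Z₀} ⊆ {h | h ∈ Z₀ ∧ h ∈ Z₁} := by
    rintro y ⟨hy, hly⟩
    refine ⟨?_, hy⟩
    by_cases hys : y ∈ s
    · exact e10 y hys hy
    · have := full₀ _ (fun k => hys ((hs l hl y).1 k)) hly l⁻¹ (P.inv_mem hl)
      rwa [inv_mul_cancel_left] at this
  -- Both correlation sets lie in Z₀ ∩ Z₁, so their total size forces equality; h and lh are then
  -- two points of Z₁ in one P-coset inside s.
  have c := corr l hl
  have i2 := Set.ncard_le_ncard s2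
  have heq := Set.eq_of_subset_of_ncard_le s1 (by omega)
  have hm : h ∈ {h | h ∈ Z₀ ∧ h ∈ Z₁} := ⟨hh, e01 h hhs hh⟩
  rw [← heq] at hm
  exact hl1 (single₁ h hhs (e01 h hhs hh) l hl hm.2)

/-! ### Levels with respect to a prime p -/

/-- Data attached to an odd prime divisor `p` of `n`: the subgroup `P` of all solutions of
`x ^ p = 1` has order `p`, and `c` is the part of `n` prime to `p`. -/
structure PrimeLayer {G : Type*} [CommGroup G] (n p c : ℕ) (P : Subgroup G) : Prop where
  prime : p.Prime
  ne_two : p ≠ 2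
  eq_mul : ∃ e, n = p ^ e * c
  not_dvd : ¬ p ∣ c
  mem_iff : ∀ x : G, x ∈ P ↔ x ^ p = 1
  card : Nat.card P = p

namespace PrimeLayer

variable {G : Type*} [CommGroup G] {n p c : ℕ} {P : Subgroup G}

theorem exists_pow (R : PrimeLayer n p c P) {t l : G} (ht : t ∈ P) (ht1 : t ≠ 1) (hl : l ∈ P) :
    ∃ i : ℕ, t ^ i = l := by
  have := Fact.mk R.prime
  obtain ⟨i, hi⟩ := mem_powers_of_prime_card (g := (⟨t, ht⟩ : P)) (g' := ⟨l, hl⟩) R.card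
    (fun k => ht1 (congrArg Subtype.val k))
  exact ⟨i, congrArg Subtype.val hi⟩

theorem exists_ne_one (R : PrimeLayer n p c P) : ∃ l ∈ P, l ≠ 1 := by
  have : Finite P := Nat.finite_of_card_ne_zero (R.card ▸ R.prime.ne_zero)
  have h1 : 1 < Nat.card P := R.card ▸ R.prime.one_lt
  have := Finite.one_lt_card_iff_nontrivial.1 h1
  obtain ⟨l, hl⟩ := exists_ne (1 : P)
  exact ⟨l, l.2, fun k => hl (Subtype.ext k)⟩

theorem coprime_two_mul (R : PrimeLayer n p c P) : (2 * c).Coprime p := by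
  rw [Nat.coprime_comm, R.prime.coprime_iff_not_dvd, R.prime.dvd_mul]
  rintro (h | h)
  · exact R.ne_two ((Nat.prime_dvd_prime_iff_eq R.prime Nat.prime_two).1 h)
  · exact R.not_dvd h

theorem eq_one (R : PrimeLayer n p c P) {l : G} (hl : l ∈ P) (h : l ^ (2 * c) = 1) : l = 1 := by
  have h1 := orderOf_dvd_of_pow_eq_one h
  have h2 := orderOf_dvd_of_pow_eq_one ((R.mem_iff l).1 hl)
  have := Nat.dvd_gcd h1 h2
  rw [R.coprime_two_mul.gcd_eq_one, Nat.dvd_one, orderOf_eq_one_iff] at this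
  exact this

theorem sq_ne_one (R : PrimeLayer n p c P) {l : G} (hl : l ∈ P) (hl1 : l ≠ 1) : l * l ≠ 1 := by
  intro h
  apply hl1
  refine R.eq_one hl ?_
  rw [pow_mul, pow_two, h, one_pow]

/-- These multipliers fix every element killed by 2cp^k and move an element killed by 2cp^(k+1)
within its P-coset. -/
theorem coprime_multiplier (R : PrimeLayer n p c P) {k : ℕ} (hk : 1 ≤ k) (i : ℕ) :
    (1 + 2 * c * p ^ k * i).Coprime (4 * n) := by
  by_contra hcon
  obtain ⟨q, hq, hqm, hqn⟩ := Nat.Prime.not_coprime_iff_dvd.1 hcon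
  obtain ⟨e, rfl⟩ := R.eq_mul
  have h1 : q ∣ 2 * c * p ^ k := by
    rw [hq.dvd_mul, hq.dvd_mul] at hqn
    rcases hqn with h | h | h
    · have : q ∣ 2 := hq.dvd_of_dvd_pow (n := 2) (by simpa using h)
      exact (this.mul_right c).mul_right _
    · exact Dvd.dvd.mul_left (dvd_pow (hq.dvd_of_dvd_pow h) (by omega)) _
    · exact (h.mul_left 2).mul_right _
  have h2 : q ∣ 1 := (Nat.dvd_add_left (h1.mul_right i)).1 hqm
  exact hq.one_lt.ne' (Nat.dvd_one.1 h2)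

theorem pow_of_mem (R : PrimeLayer n p c P) {l : G} (hl : l ∈ P) {k : ℕ} (hk : 1 ≤ k) :
    l ^ (2 * c * p ^ k) = 1 := by
  obtain ⟨j, rfl⟩ : ∃ j, k = j + 1 := ⟨k - 1, by omega⟩
  rw [pow_succ, ← mul_assoc, mul_comm, pow_mul, (R.mem_iff l).1 hl, one_pow]

/-- The p-part of g has order p^(k+1); the hypothesis excludes k = 0. -/
theorem exists_level (R : PrimeLayer n p c P) (hG : ∀ g : G, g ^ (2 * n) = 1) {g : G}
    (hg : g ^ (2 * c * p) ≠ 1) :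
    ∃ k, 1 ≤ k ∧ g ^ (2 * c * p ^ k) ≠ 1 ∧ g ^ (2 * c * p ^ (k + 1)) = 1 := by
  classical
  have hex : ∃ k, g ^ (2 * c * p ^ k) = 1 := by
    obtain ⟨e, he⟩ := R.eq_mul
    refine ⟨e, ?_⟩
    rw [mul_assoc, mul_comm c, ← he]
    exact hG g
  have hspec := Nat.find_spec hex
  have h2 : 2 ≤ Nat.find hex := by
    by_contra hlt
    apply hg
    have : Nat.find hex = 0 ∨ Nat.find hex = 1 := by omega
    rcases this with h | h
    · rw [h, pow_zero, mul_one] at hspec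
      rw [pow_mul, hspec, one_pow]
    · rwa [h, pow_one] at hspec
  refine ⟨Nat.find hex - 1, by omega, Nat.find_min hex (by omega), ?_⟩
  rwa [show Nat.find hex - 1 + 1 = Nat.find hex by omega]

theorem level_mem (R : PrimeLayer n p c P) {k : ℕ} {z : G}
    (hz : z ^ (2 * c * p ^ (k + 1)) = 1) : z ^ (2 * c * p ^ k) ∈ P := by
  rw [R.mem_iff, ← pow_mul, mul_assoc, ← pow_succ, hz]

end PrimeLayer

namespace KleinExt

section Elementary

variable {G : Type*} [CommGroup G] {H H₀ : Subgroup G} {n p c : ℕ} {a b : G} {P : Subgroup G}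

theorem mul_self_mem (S : KleinExt H H₀ n a b) (x : G) : x * x ∈ H₀ := by
  have key : ∀ h ∈ H₀, ∀ e : G, e * e = 1 → h * e * (h * e) ∈ H₀ := by
    intro h hh e he
    rw [mul_mul_mul_comm, he, mul_one]
    exact H₀.mul_mem hh hh
  by_cases hx : x ∈ H
  · obtain ⟨h, hh, rfl | rfl⟩ := S.inside x hx
    · exact H₀.mul_mem hh hh
    · exact key h hh b S.bb
  · obtain ⟨h, hh, rfl | rfl⟩ := S.outside x hx
    · exact key h hh a S.aa
    · exact key h hh _ S.abab

theorem pow_two_mul (S : KleinExt H H₀ n a b) (x : G) : x ^ (2 * n) = 1 := by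
  rw [pow_mul, pow_two]
  exact S.pow_eq_one _ (S.mul_self_mem x)

theorem coprime_multiplier (S : KleinExt H H₀ n a b) (R : PrimeLayer n p c P) {k : ℕ}
    (hk : 1 ≤ k) (i : ℕ) : (1 + 2 * c * p ^ k * i).Coprime (Nat.card G) := by
  rw [S.card]
  exact R.coprime_multiplier hk i

end Elementary

/-! ### The case a ~ ab with U₀ nontrivial -/

section Linked

variable {G : Type*} [CommGroup G] [Finite G] {A : SchurRing G}
variable {H H₀ : Subgroup G} {n p c : ℕ} {a b : G} {P : Subgroup G}

open SchurRing

/-- A multiplier 1 + 2cp^k·i fixes y and sends z to zl, so z ~ y ~ zl. -/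
theorem rel_full_of_lower (S : KleinExt H H₀ n a b) (R : PrimeLayer n p c P) {k : ℕ} (hk : 1 ≤ k)
    {y z : G} (h : A.Rel z y) (hy : y ^ (2 * c * p ^ k) = 1) (hz : z ^ (2 * c * p ^ k) ≠ 1)
    (hz' : z ^ (2 * c * p ^ (k + 1)) = 1) : ∀ l ∈ P, A.Rel z (z * l) := by
  intro l hl
  obtain ⟨i, hi⟩ := R.exists_pow (R.level_mem hz') hz hl
  have := h.pow (S.coprime_multiplier R hk i)
  rw [pow_add, pow_add, pow_one, pow_one, pow_mul z, hi, pow_mul y, hy, one_pow, mul_one] at this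
  exact h.trans this.symm

/-- The multiplier taking y to yl takes z to z times a nontrivial element of P. It fixes P
pointwise, so iterating it reaches the whole coset zP. -/
theorem rel_full_of_same (S : KleinExt H H₀ n a b) (R : PrimeLayer n p c P) {k : ℕ} (hk : 1 ≤ k)
    {y z : G} (h : A.Rel z y) (hy : y ^ (2 * c * p ^ k) ≠ 1)
    (hy' : y ^ (2 * c * p ^ (k + 1)) = 1) (hz : z ^ (2 * c * p ^ k) ≠ 1)
    (hz' : z ^ (2 * c * p ^ (k + 1)) = 1) {l : G} (hl : l ∈ P) (hl1 : l ≠ 1)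
    (hyl : A.Rel y (y * l)) : ∀ l ∈ P, A.Rel z (z * l) := by
  obtain ⟨i, hi⟩ := R.exists_pow (R.level_mem hy') hy hl
  set t := z ^ (2 * c * p ^ k) with ht
  have htP : t ∈ P := R.level_mem hz'
  have hti : t ^ i ≠ 1 := by
    intro h0
    have hpi : p ∣ i := by
      have := orderOf_eq_prime ((R.mem_iff t).1 htP) hz
        (hp := Fact.mk R.prime)
      rw [← this]
      exact orderOf_dvd_of_pow_eq_one h0
    obtain ⟨j, rfl⟩ := hpi
    apply hl1
    rw [← hi, pow_mul, (R.mem_iff _).1 (R.level_mem hy'), one_pow]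
  have hm := S.coprime_multiplier R hk i
  have hzm : z ^ (1 + 2 * c * p ^ k * i) = z * t ^ i := by
    rw [pow_add, pow_one, pow_mul]
  have hym : y ^ (1 + 2 * c * p ^ k * i) = y * l := by
    rw [pow_add, pow_one, pow_mul, hi]
  have hz1 : A.Rel z (z * t ^ i) := by
    have := h.pow hm
    rw [hzm, hym] at this
    exact (h.trans hyl).trans this.symm
  have hstep : ∀ r : ℕ, A.Rel z (z * (t ^ i) ^ r) := by
    intro r
    induction r with
    | zero => rw [pow_zero, mul_one]; exact Rel.refl z
    | succ r ih =>
      have := ih.pow hm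
      have hfix : ((t ^ i) ^ r) ^ (1 + 2 * c * p ^ k * i) = (t ^ i) ^ r := by
        rw [pow_add, pow_one, pow_mul, R.pow_of_mem (P.pow_mem (P.pow_mem htP i) r) hk, one_pow,
          mul_one]
      rw [mul_pow, hzm, hfix, mul_assoc, ← pow_succ'] at this
      exact hz1.trans this
  intro l' hl'
  obtain ⟨r, rfl⟩ := R.exists_pow (P.pow_mem htP i) hti hl'
  exact hstep r

/-- When `a` and `a * b` are related, no nonempty closed set outside `H` consists of elements of
order prime to `p`. -/
theorem eq_empty_of_level_zero (S : KleinExt H H₀ n a b) (hH : A.Closed (H : Set G))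
    (R : PrimeLayer n p c P) (hab : A.Rel a (a * b)) {U₀ : Subgroup G} (hU : U₀ ≤ H₀)
    (hUb : ∀ h ∈ H₀, h ∈ U₀ ↔ A.Rel b (h * b)) (hPU : P ≤ U₀) {N : Set G} (hN : A.Closed N)
    (hNH : ∀ v ∈ N, v ∉ H) (hN0 : ∀ v ∈ N, v ^ (2 * c) = 1) : N = ∅ := by
  -- If N met both H₀a and H₀ab, N * N would meet H₀b and so absorb P by `rel_mul_b`, although all
  -- its elements are killed by 2c.
  have hnot : ∀ x ∈ H₀, ∀ y ∈ H₀, x * a ∈ N → y * (a * b) ∉ N := by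
    intro x hx y hy hxN hyN
    obtain ⟨l, hl, hl1⟩ := R.exists_ne_one
    have hxy : x * y * b ∈ N * N := by
      refine ⟨x * a, hxN, y * (a * b), hyN, ?_⟩
      calc x * a * (y * (a * b)) = x * y * b * (a * a) := by simp only [mul_comm, mul_left_comm]
        _ = _ := by rw [S.aa, mul_one]
    have hlxy := (hN.mul hN) (S.rel_mul_b hH hU hUb (H₀.mul_mem hx hy) (hPU hl)) hxy
    have h0 : ∀ v ∈ N * N, v ^ (2 * c) = 1 := by
      rintro _ ⟨v, hv, w, hw, rfl⟩
      simp only [mul_pow, hN0 v hv, hN0 w hw, mul_one]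
    have h1 := h0 _ hlxy
    rw [mul_assoc l, mul_pow, h0 _ hxy, mul_one] at h1
    exact hl1 (R.eq_one hl h1)
  have hDc := S.closed_xor_outside hN hNH
  -- N lies over only one of a, ab. Comparing structure constants at a and ab equates the size of
  -- its projection with 0.
  have hc := ncard_eq_of_rel hN hDc hab
  rw [Set.eq_empty_iff_forall_notMem]
  intro v hv
  obtain ⟨x, hx, rfl | rfl⟩ := S.outside v (hNH v hv)
  · have e : {y | y ∈ {h | h ∈ H₀ ∧ ¬(h * a ∈ N ↔ h * (a * b) ∈ N)} ∧ a * b * y ∈ N} = ∅ := by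
      rw [Set.eq_empty_iff_forall_notMem]
      rintro y ⟨hy, hyN⟩
      rw [mul_comm] at hyN
      exact hnot x hx y hy.1 hv hyN
    rw [e, Set.ncard_empty, Set.ncard_eq_zero, Set.eq_empty_iff_forall_notMem] at hc
    exact hc x ⟨⟨hx, fun k => hnot x hx x hx hv (k.1 hv)⟩, by rwa [mul_comm]⟩
  · have e : {y | y ∈ {h | h ∈ H₀ ∧ ¬(h * a ∈ N ↔ h * (a * b) ∈ N)} ∧ a * y ∈ N} = ∅ := by
      rw [Set.eq_empty_iff_forall_notMem]
      rintro y ⟨hy, hyN⟩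
      rw [mul_comm] at hyN
      exact hnot y hy.1 x hx hyN hv
    rw [e, Set.ncard_empty, eq_comm, Set.ncard_eq_zero, Set.eq_empty_iff_forall_notMem] at hc
    exact hc x ⟨⟨hx, fun k => hnot x hx x hx (k.2 hv) hv⟩, by rwa [mul_comm]⟩

/-- Fibres of the p-th power map are P-cosets. Where the p-part has order above p they are full by
hypothesis, so the p-th powers hit a number of times prime to p are killed by 2c. By
`eq_empty_of_level_zero` there are none, and the nonempty fibre through z is a full coset. -/
theorem rel_full_of_levels (S : KleinExt H H₀ n a b) (hH : A.Closed (H : Set G))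
    (R : PrimeLayer n p c P) (hab : A.Rel a (a * b)) {U₀ : Subgroup G} (hU : U₀ ≤ H₀)
    (hUb : ∀ h ∈ H₀, h ∈ U₀ ↔ A.Rel b (h * b)) (hPU : P ≤ U₀) {z : G} (hz : z ∉ H)
    (hfull : ∀ y, A.Rel z y → y ^ (2 * c * p) ≠ 1 → ∀ l ∈ P, A.Rel y (y * l)) :
    ∀ l ∈ P, A.Rel z (z * l) := by
  set V := A.cls z with hV
  have hVc : A.Closed V := closed_cls z
  have hVH : ∀ v ∈ V, v ∉ H := fun v hv k => hz (hH (Rel.symm hv) k)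
  have hfib : ∀ x y : G, y ^ p = x ^ p → x⁻¹ * y ∈ P := by
    intro x y h
    rw [R.mem_iff, mul_pow, h, inv_pow, inv_mul_cancel]
  have hsub : ∀ x : G, {y | y ∈ V ∧ y ^ p = x ^ p} ⊆ (fun l => x * l) '' (P : Set G) := by
    rintro x y ⟨-, hy⟩
    exact ⟨x⁻¹ * y, hfib x y hy, mul_inv_cancel_left x y⟩
  have hcard : ∀ x : G, ((fun l => x * l) '' (P : Set G)).ncard = p := by
    intro x
    rw [Set.ncard_image_of_injective _ (mul_right_injective x)]
    exact R.card
  have hN := hVc.frobenius R.prime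
  have hempty := S.eq_empty_of_level_zero hH R hab hU hUb hPU hN ?_ ?_
  · have hdvd : p ∣ {y | y ∈ V ∧ y ^ p = z ^ p}.ncard := by
      by_contra hcon
      have : z ^ p ∈ {g | ¬ p ∣ {x | x ∈ V ∧ x ^ p = g}.ncard} := hcon
      rw [hempty] at this
      exact this
    have hpos : 0 < {y | y ∈ V ∧ y ^ p = z ^ p}.ncard :=
      (Set.ncard_pos).2 ⟨z, mem_cls_self z, rfl⟩
    have heq := Set.eq_of_subset_of_ncard_le (hsub z) (by
      rw [hcard]; exact Nat.le_of_dvd hpos hdvd)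
    intro l hl
    have hm : z * l ∈ (fun l => z * l) '' (P : Set G) := ⟨l, hl, rfl⟩
    rw [← heq] at hm
    exact hm.1
  · intro g hg hgH
    have hne : {x | x ∈ V ∧ x ^ p = g}.Nonempty := by
      rw [Set.nonempty_iff_ne_empty]
      intro h0
      simp [h0] at hg
    obtain ⟨x, hx, rfl⟩ := hne
    obtain ⟨j, hj⟩ := R.prime.odd_of_ne_two R.ne_two
    apply hVH x hx
    rw [hj, pow_succ, pow_mul, pow_two] at hgH
    exact (H.mul_mem_cancel_left (H.pow_mem (S.le (S.mul_self_mem x)) j)).1 hgH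
  · intro g hg
    have hne : {x | x ∈ V ∧ x ^ p = g}.Nonempty := by
      rw [Set.nonempty_iff_ne_empty]
      intro h0
      simp [h0] at hg
    obtain ⟨x, hx, rfl⟩ := hne
    by_contra hcon
    apply hg
    have hf := hfull x hx (by rwa [mul_comm, pow_mul])
    have : {y | y ∈ V ∧ y ^ p = x ^ p} = (fun l => x * l) '' (P : Set G) := by
      refine (hsub x).antisymm ?_
      rintro _ ⟨l, hl, rfl⟩
      refine ⟨Rel.trans hx (hf l hl), ?_⟩
      simp only [mul_pow, (R.mem_iff l).1 hl, mul_one]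
    rw [this, hcard]

/-- When `a` and `a * b` are related, every basic set outside `H` is invariant under each subgroup
of prime order of `U₀`. -/
theorem rel_mul_of_prime (S : KleinExt H H₀ n a b) (hH : A.Closed (H : Set G))
    (R : PrimeLayer n p c P) (hab : A.Rel a (a * b)) {U₀ : Subgroup G} (hU : U₀ ≤ H₀)
    (hUb : ∀ h ∈ H₀, h ∈ U₀ ↔ A.Rel b (h * b)) (hPU : P ≤ U₀) {h : G} (hh : h ∈ H₀) :
    ∀ l ∈ P, A.Rel (h * a) (h * a * l) := by
  have hG := S.pow_two_mul
  have hpow : ∀ e : G, e * e = 1 → ∀ x : G, ∀ k, (x * e) ^ (2 * c * p ^ k) = x ^ (2 * c * p ^ k) := by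
    intro e he x k
    rw [mul_pow, mul_assoc 2, pow_mul e, pow_two, he, one_pow, mul_one]
  have ha1 : ∀ k, a ^ (2 * c * p ^ k) = 1 := fun k => by
    have := hpow a S.aa 1 k
    rwa [one_mul, one_pow] at this
  have hTfull : ∀ y, A.Rel a y → y ^ (2 * c * p) ≠ 1 → ∀ l ∈ P, A.Rel y (y * l) := by
    intro y hy hy1
    obtain ⟨k, hk, h1, h2⟩ := R.exists_level hG hy1
    exact S.rel_full_of_lower R hk hy.symm (ha1 k) h1 h2
  have hTa : ∀ l ∈ P, A.Rel a (a * l) :=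
    S.rel_full_of_levels hH R hab hU hUb hPU S.a_notMem hTfull
  have hTab : ∀ l ∈ P, A.Rel (a * b) (a * b * l) :=
    S.rel_full_of_levels hH R hab hU hUb hPU S.swap.a_notMem (fun y hy => hTfull y (hab.trans hy))
  by_cases hA : ∀ y, A.Rel (h * a) y → y ^ (2 * c * p) ≠ 1 → ∀ l ∈ P, A.Rel y (y * l)
  · exact S.rel_full_of_levels hH R hab hU hUb hPU (S.mul_a_notMem hh) hA
  push Not at hA
  obtain ⟨z, hz, hz1, l₀, hl₀, hzl₀⟩ := hA
  obtain ⟨k, hk, hk1, hk2⟩ := R.exists_level hG hz1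
  set V := A.cls (h * a) with hV
  have hVc : A.Closed V := closed_cls _
  have hVH : ∀ v ∈ V, v ∉ H := fun v hv i => S.mul_a_notMem hh (hH (Rel.symm hv) i)
  -- One element z at level k whose P-coset is not contained in V forces the shape of V: nothing
  -- below level k, at most one point per P-coset at level k, and full cosets above.
  have hlow : ∀ y ∈ V, y ^ (2 * c * p ^ k) ≠ 1 := fun y hy h0 =>
    hzl₀ (S.rel_full_of_lower R hk (hz.symm.trans hy) h0 hk1 hk2 l₀ hl₀)
  have hsingle : ∀ y ∈ V, y ^ (2 * c * p ^ (k + 1)) = 1 → ∀ l ∈ P, y * l ∈ V → l = 1 := by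
    intro y hy hy1 l hl hyl
    by_contra hl1
    exact hzl₀ (S.rel_full_of_same R hk (hz.symm.trans hy) (hlow y hy) hy1 hk1 hk2 hl hl1
      (Rel.trans (Rel.symm hy) hyl) l₀ hl₀)
  have hfull : ∀ y ∈ V, y ^ (2 * c * p ^ (k + 1)) ≠ 1 → ∀ l ∈ P, y * l ∈ V := by
    intro y hy hy1 l hl
    have hmono : ∀ g : G, ∀ i j : ℕ, i ≤ j → g ^ (2 * c * p ^ i) = 1 → g ^ (2 * c * p ^ j) = 1 := by
      intro g i j hij hg
      obtain ⟨d, rfl⟩ := Nat.exists_eq_add_of_le hij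
      rw [pow_add, ← mul_assoc, pow_mul, hg, one_pow]
    have hy0 : y ^ (2 * c * p) ≠ 1 := fun h0 => hy1 (hmono y 1 (k + 1) (by omega) (by rwa [pow_one]))
    obtain ⟨j, hj, hj1, hj2⟩ := R.exists_level hG hy0
    have hkj : k + 1 ≤ j := by
      by_contra hlt
      exact hy1 (hmono y (j + 1) (k + 1) (by omega) hj2)
    exact Rel.trans hy (S.rel_full_of_lower R hj ((Rel.symm hy).trans hz) (hmono z _ _ hkj hk2)
      hj1 hj2 l hl)
  have hcomm : ∀ l x e : G, l * x * e = x * e * l := fun l x e => by rw [mul_assoc, mul_comm]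
  obtain ⟨l, hl, hl1⟩ := R.exists_ne_one
  have hDc := S.closed_xor_outside hVc hVH
  have hsetD : ∀ e : G, ∀ l : G,
      {y | ¬ (y ∈ {x | x ∈ H₀ ∧ x * a ∈ V} ↔ y ∈ {x | x ∈ H₀ ∧ x * (a * b) ∈ V}) ∧
        y ∈ H₀ ∧ y * e * l ∈ V} =
      {y | y ∈ {h | h ∈ H₀ ∧ ¬(h * a ∈ V ↔ h * (a * b) ∈ V)} ∧ e * l * y ∈ V} := by
    intro e l
    ext y
    simp only [Set.mem_ofPred_eq]
    rw [show e * l * y = y * e * l by simp only [mul_comm, mul_left_comm]]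
    tauto
  have hcorr : ∀ e : G, (∀ l ∈ P, A.Rel e (e * l)) → ∀ l ∈ P,
      {y | ¬ (y ∈ {x | x ∈ H₀ ∧ x * a ∈ V} ↔ y ∈ {x | x ∈ H₀ ∧ x * (a * b) ∈ V}) ∧
        l * y ∈ {x | x ∈ H₀ ∧ x * e ∈ V}}.ncard =
      {y | ¬ (y ∈ {x | x ∈ H₀ ∧ x * a ∈ V} ↔ y ∈ {x | x ∈ H₀ ∧ x * (a * b) ∈ V}) ∧
        y ∈ {x | x ∈ H₀ ∧ x * e ∈ V}}.ncard := by
    intro e he l hl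
    have h1 := ncard_eq_of_rel hVc hDc (he l hl)
    have h2 := hsetD e l
    have h3 := hsetD e 1
    simp only [mul_one] at h3
    rw [← h2, ← h3] at h1
    refine Eq.trans ?_ h1.symm
    congr 1
    ext y
    simp only [Set.mem_ofPred_eq, hcomm l y e, H₀.mul_mem_cancel_left (hU (hPU hl))]
  -- With s the elements killed by 2cp^(k+1), rigidity places h outside s, where cosets are full.
  have hns := notMem_of_correlation (P := P) (s := {x | x ^ (2 * c * p ^ (k + 1)) = 1})
    (Z₀ := {x | x ∈ H₀ ∧ x * a ∈ V}) (Z₁ := {x | x ∈ H₀ ∧ x * (a * b) ∈ V})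
    ?_ ?_ ?_ ?_ ?_ (hcorr a hTa) (hcorr (a * b) hTab) ?_ hl hl1 (R.sq_ne_one hl hl1)
    (h := h) ⟨hh, mem_cls_self _⟩
  · intro l hl
    refine hfull _ (mem_cls_self _) ?_ l hl
    rw [hpow a S.aa]
    exact hns
  · intro l hl x
    simp only [Set.mem_ofPred_eq, mul_pow, R.pow_of_mem hl (Nat.le_add_left 1 k), one_mul]
  · intro x hx hxZ l hl hlx
    refine hsingle _ hxZ.2 (by rw [hpow a S.aa]; exact hx) l hl ?_
    rw [← hcomm]; exact hlx.2
  · intro x hx hxZ l hl hlx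
    refine hsingle _ hxZ.2 (by rw [hpow _ S.abab]; exact hx) l hl ?_
    rw [← hcomm]; exact hlx.2
  · intro x hx hxZ l hl
    refine ⟨H₀.mul_mem (hU (hPU hl)) hxZ.1, ?_⟩
    rw [hcomm]
    exact hfull _ hxZ.2 (by rw [hpow a S.aa]; exact hx) l hl
  · intro x hx hxZ l hl
    refine ⟨H₀.mul_mem (hU (hPU hl)) hxZ.1, ?_⟩
    rw [hcomm]
    exact hfull _ hxZ.2 (by rw [hpow _ S.abab]; exact hx) l hl
  · intro l hl
    have hlH := hU (hPU hl)
    have := S.ncard_correlation hVc hVH hlH ((hUb l hlH).1 (hPU hl))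
    convert this using 3
    · congr 1
      ext x
      simp only [Set.mem_ofPred_eq, H₀.mul_mem_cancel_left hlH]
      tauto
    · congr 1
      ext x
      simp only [Set.mem_ofPred_eq, H₀.mul_mem_cancel_left hlH]
      tauto
    · congr 1
      ext x
      simp only [Set.mem_ofPred_eq]
      tauto

/-- Cyclicity of H₀ is needed here: x^p = 1 has at most p solutions in H₀, so a subgroup of order p
from Cauchy's theorem contains them all. Solutions in G lie in H₀ because p is odd and squares lie
in H₀. -/
theorem exists_primeLayer (S : KleinExt H H₀ n a b) [IsCyclic H₀]
    {U₀ : Subgroup G} (hU : U₀ ≤ H₀) (hU1 : U₀ ≠ ⊥) :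
    ∃ p c : ℕ, ∃ P : Subgroup G, PrimeLayer n p c P ∧ P ≤ U₀ := by
  classical
  obtain ⟨p, hp, hpU⟩ := Nat.exists_prime_and_dvd (n := Nat.card U₀)
    (fun k => hU1 (Subgroup.card_eq_one.1 k))
  have := Fact.mk hp
  obtain ⟨x, hx⟩ := exists_prime_orderOf_dvd_card' p hpU
  have hxo : orderOf (x : G) = p := by rw [Subgroup.orderOf_coe, hx]
  have hpn : p ∣ n := by
    rw [← hxo]
    exact orderOf_dvd_of_pow_eq_one (S.pow_eq_one _ (hU x.2))
  have hp2 : p ≠ 2 := by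
    rintro rfl
    exact Nat.not_even_iff_odd.2 S.odd (even_iff_two_dvd.2 hpn)
  have hn0 : n ≠ 0 := by
    rintro rfl
    exact Nat.not_odd_zero S.odd
  have hle : Subgroup.zpowers (x : G) ≤ U₀ := Subgroup.zpowers_le.2 x.2
  refine ⟨p, n / p ^ n.factorization p, Subgroup.zpowers (x : G), ⟨hp, hp2,
    ⟨n.factorization p, (Nat.ordProj_mul_ordCompl_eq_self n p).symm⟩,
    Nat.not_dvd_ordCompl hp hn0, ?_, by rw [Nat.card_zpowers, hxo]⟩, hle⟩
  intro y
  constructor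
  · rintro ⟨i, rfl⟩
    simp only
    rw [← zpow_natCast, ← zpow_mul, mul_comm, zpow_mul, zpow_natCast, ← hxo, pow_orderOf_eq_one,
      one_zpow]
  · intro hy
    have hyH : y ∈ H₀ := by
      obtain ⟨j, hj⟩ := hp.odd_of_ne_two hp2
      rw [hj, pow_succ, pow_mul, pow_two] at hy
      rw [← H₀.mul_mem_cancel_left (H₀.pow_mem (S.mul_self_mem y) j), hy]
      exact H₀.one_mem
    have : Fintype H₀ := Fintype.ofFinite _
    have hle1 := IsCyclic.card_pow_eq_one_le (α := H₀) hp.pos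
    set Z : Finset G := Finset.univ.filter (fun z : H₀ => z ^ p = 1) |>.image Subtype.val with hZ
    have hZcard : Z.card ≤ p := Finset.card_image_le.trans hle1
    have hsub : (Subgroup.zpowers (x : G) : Set G).toFinite.toFinset ⊆ Z := by
      intro g hg
      simp only [Set.Finite.mem_toFinset, SetLike.mem_coe] at hg
      have hgp : g ^ p = 1 := by
        obtain ⟨i, rfl⟩ := hg
        simp only
        rw [← zpow_natCast, ← zpow_mul, mul_comm, zpow_mul, zpow_natCast, ← hxo,
          pow_orderOf_eq_one, one_zpow]
      simp only [hZ, Finset.mem_image, Finset.mem_filter, Finset.mem_univ, true_and]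
      exact ⟨⟨g, hU (hle hg)⟩, Subtype.ext hgp, rfl⟩
    have hcardz : (Subgroup.zpowers (x : G) : Set G).toFinite.toFinset.card = p := by
      rw [← Set.ncard_eq_toFinset_card]
      exact (Nat.card_zpowers (x : G)).trans hxo
    have heq := Finset.eq_of_subset_of_card_le hsub (by rw [hcardz]; exact hZcard)
    have hyZ : y ∈ Z := by
      simp only [hZ, Finset.mem_image, Finset.mem_filter, Finset.mem_univ, true_and]
      exact ⟨⟨y, hyH⟩, Subtype.ext hy, rfl⟩
    rw [← heq] at hyZ
    simpa using hyZ

theorem exists_radical (S : KleinExt H H₀ n a b) [IsCyclic H₀]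
    (hH : A.Closed (H : Set G)) (ha : A.cls a ≠ {a}) (hab : A.cls a ≠ {a, a * b}) :
    ∃ r ∈ H₀, r ≠ 1 ∧ ∀ h ∈ H₀, A.Rel (h * a) (r * h * a) := by
  by_cases hrel : A.Rel a (a * b)
  · obtain ⟨U₀, hU, hUb, hUc⟩ := S.exists_bSubgroup hH
    -- For trivial U₀ the closed set U₀ × {1, b} is {1, b}, so {b} is basic.
    by_cases hU1 : U₀ = ⊥
    · refine S.exists_radical_of_cls_b hH hrel ?_ hab
      ext z
      constructor
      · intro hz
        have := hUc hz (Or.inr (by rw [S.bb]; exact U₀.one_mem))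
        rw [hU1] at this
        rcases this with h | h
        · rw [Subgroup.mem_bot] at h
          subst h
          have := Rel.eq_one (Rel.symm hz)
          exact absurd (this ▸ H₀.one_mem) S.b_notMem
        · rw [Subgroup.mem_bot] at h
          rw [Set.mem_singleton_iff, eq_inv_of_mul_eq_one_left h,
            inv_eq_of_mul_eq_one_left S.bb]
      · rintro rfl
        exact mem_cls_self _
    · obtain ⟨p, c, P, R, hPU⟩ := S.exists_primeLayer hU hU1
      obtain ⟨l, hl, hl1⟩ := R.exists_ne_one
      refine ⟨l, hU (hPU hl), hl1, fun h hh => ?_⟩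
      have := S.rel_mul_of_prime hH R hrel hU hUb hPU hh l hl
      rwa [mul_comm _ l, ← mul_assoc] at this
  · exact S.exists_radical_of_not_rel hH hrel ha

end Linked

end KleinExt

theorem KleinExt.of_isCompl {G : Type*} [CommGroup G] [Finite G] {n : ℕ} (hodd : Odd n)
    {H : Subgroup G} (hH : Nat.card H = 2 * n) {a : G} (ha : orderOf a = 2)
    (hG : IsCompl H (Subgroup.zpowers a)) {b : G} (hbH : b ∈ H) (hb : orderOf b = 2)
    {H₀ : Subgroup G} (hH₀H : H₀ ≤ H) (hH₀ : Nat.card H₀ = n) : KleinExt H H₀ n a b := by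
  have hpow : ∀ h ∈ H₀, h ^ n = 1 := fun h hh => by
    rw [← hH₀]
    exact congrArg Subtype.val (pow_card_eq_one' (x := (⟨h, hh⟩ : H₀)))
  have haa : a * a = 1 := by rw [← pow_two, ← ha, pow_orderOf_eq_one]
  have hbb : b * b = 1 := by rw [← pow_two, ← hb, pow_orderOf_eq_one]
  have hb₀ : b ∉ H₀ := by
    intro k
    obtain ⟨j, hj⟩ := hodd
    have h1 := hpow b k
    rw [hj, pow_succ, pow_mul, pow_two, hbb, one_pow, one_mul] at h1
    rw [h1, orderOf_one] at hb
    omega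
  have hn0 : 0 < n := hodd.pos
  have hrel : H₀.relIndex H = 2 := by
    have := Subgroup.relIndex_mul_relIndex ⊥ H₀ H bot_le hH₀H
    rw [Subgroup.relIndex_bot_left, Subgroup.relIndex_bot_left, hH₀, hH, mul_comm 2] at this
    exact Nat.eq_of_mul_eq_mul_left hn0 this
  have hinside : ∀ g ∈ H, ∃ h ∈ H₀, g = h ∨ g = h * b := by
    intro g hg
    by_cases hg0 : g ∈ H₀
    · exact ⟨g, hg0, Or.inl rfl⟩
    · refine ⟨g * b, ?_, Or.inr (by rw [mul_assoc, hbb, mul_one])⟩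
      have := Subgroup.mul_mem_iff_of_index_two (H := H₀.subgroupOf H) hrel
        (a := ⟨g, hg⟩) (b := ⟨b, hbH⟩)
      simp only [Subgroup.mem_subgroupOf, MulMemClass.mk_mul_mk] at this
      exact this.2 (iff_of_false hg0 hb₀)
  have hcoset : ∀ g : G, ∃ h ∈ H, g = h ∨ g = h * a := by
    intro g
    have hg : g ∈ H ⊔ Subgroup.zpowers a := by rw [hG.sup_eq_top]; trivial
    obtain ⟨h, hh, z, ⟨i, rfl⟩, rfl⟩ := Subgroup.mem_sup.1 hg
    refine ⟨h, hh, ?_⟩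
    simp only
    rcases Int.even_or_odd' i with ⟨j, rfl | rfl⟩
    · left; rw [zpow_mul, zpow_two, haa, one_zpow, mul_one]
    · right; rw [zpow_add, zpow_mul, zpow_two, haa, one_zpow, one_mul, zpow_one]
  have haH : a ∉ H := by
    intro k
    have := hG.inf_eq_bot ▸ Subgroup.mem_inf.2 ⟨k, Subgroup.mem_zpowers a⟩
    rw [Subgroup.mem_bot] at this
    rw [this, orderOf_one] at ha
    omega
  have hcard : Nat.card G = 4 * n := by
    have := (Subgroup.isComplement'_of_disjoint_and_mul_eq_univ hG.disjoint (by
      rw [← Subgroup.mul_normal, hG.sup_eq_top, Subgroup.coe_top])).card_mul_card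
    rw [hH, Nat.card_zpowers, ha] at this
    omega
  refine ⟨hodd, hcard, hpow, hH₀H, hbH, hb₀, haH, haa, hbb, hinside, ?_⟩
  intro g hg
  obtain ⟨h, hh, rfl | rfl⟩ := hcoset g
  · exact absurd hh hg
  · obtain ⟨k, hk, rfl | rfl⟩ := hinside h hh
    · exact ⟨h, hk, Or.inl rfl⟩
    · exact ⟨k, hk, Or.inr (by rw [mul_assoc, mul_comm b])⟩

theorem mem_rad_of_forall {G : Type*} [CommGroup G] [Finite G] {X : Set G} {r : G}
    (h : ∀ x ∈ X, r * x ∈ X) : r ∈ rad X := by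
  have h1 : r • X = X := by
    refine Set.eq_of_subset_of_ncard_le ?_ (Set.ncard_smul_set r X).ge
    rintro _ ⟨x, hx, rfl⟩
    exact h x hx
  refine ⟨?_, h1⟩
  rwa [op_smul_eq_smul]

end SchurRings

theorem theorem1p4 {G : Type*} [CommGroup G] [Finite G] (n : ℕ) (hn : 1 < n) (hodd : Odd n)
    (H : Subgroup G) (hcyc : IsCyclic H) (hH : Nat.card H = 2 * n)
    (a : G) (ha : orderOf a = 2) (hG : IsCompl H (Subgroup.zpowers a))
    (b : G) (hbH : b ∈ H) (hb : orderOf b = 2)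
    (H₀ : Subgroup G) (hH₀H : H₀ ≤ H) (hH₀ : Nat.card H₀ = n)
    (A : SchurRings.SchurRing G)
    (hHA : SchurRings.underline (H : Set G) ∈ A.toSubring)
    (haA : SchurRings.underline ({a} : Set G) ∉ A.toSubring) :
    ({a, a * b} : Set G) ∈ A.basicSets ∨
      (⨅ X ∈ {X ∈ A.basicSets | (X ∩ ((H₀ : Set G) * {a})).Nonempty},
        SchurRings.rad (X ∩ ((H₀ : Set G) * {a}))) ≠ ⊥ := by
  have S := SchurRings.KleinExt.of_isCompl hodd hH ha hG hbH hb hH₀H hH₀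
  have hcyc₀ : IsCyclic H₀ :=
    isCyclic_of_injective (Subgroup.inclusion hH₀H) (Subgroup.inclusion_injective hH₀H)
  by_cases hab : A.cls a = {a, a * b}
  · left
    rw [← hab]
    exact SchurRings.SchurRing.cls_mem a
  right
  have ha1 : A.cls a ≠ {a} := fun k =>
    haA (k ▸ (SchurRings.SchurRing.closed_cls a).underline_mem)
  obtain ⟨r, hr, hr1, hrel⟩ := S.exists_radical
    (SchurRings.SchurRing.closed_of_underline_mem hHA) ha1 hab
  refine fun hbot => hr1 ?_
  rw [← Subgroup.mem_bot, ← hbot]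
  simp only [Subgroup.mem_iInf]
  rintro X ⟨hX, -⟩
  refine SchurRings.mem_rad_of_forall ?_
  rintro _ ⟨hxX, h, hh, e, he, rfl⟩
  obtain rfl : e = a := he
  simp only at hxX ⊢
  rw [← mul_assoc]
  refine ⟨?_, r * h, H₀.mul_mem hr hh, e, rfl, rfl⟩
  obtain ⟨Y, hY, h1, h2⟩ := hrel h hh
  rwa [SchurRings.SchurRing.basic_eq hX hY hxX h1]
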